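/- Let $l,m\ge 1$, let $E=\bigcup_{j=1}^{l}[a_j,b_j]$ be a union of $l$ pairwise disjoint compact real intervals with $a_j<b_j$, and for $n\in\mathbb N$ let $I_n=\bigcup_{k=1}^{m}[B_{k,n},C_{k,n}]$ be a union of $m$ pairwise disjoint compact real intervals with $B_{k,n}<C_{k,n}$. Suppose that $\operatorname{dist}(E,I_n)\ge\delta$ for some $\delta>0$ independent of $n$, and that $\bigcap_{n}[B_{k,n},C_{k,n}]=\{c_k\}$ for $k=1,\dots,m$. Let $\omega_{k,n}=\omega(\infty,[B_{k,n},C_{k,n}],E\cup I_n)$ be the harmonic measure, i.e. the value at $\infty$ of the harmonic function on $\overline{\mathbb C}\setminus(E\cup I_n)$ with boundary values $1$ on $[B_{k,n},C_{k,n}]$ and $0$ on the rest of $E\cup I_n$, and suppose that $\omega_{k,n}\to0$ as $n\to\infty$ for every $k$. For a finite union $F$ of disjoint nondegenerate compact real intervals and $z_0\in\overline{\mathbb C}\setminus F$ let $\phi(\cdot,z_0,F)$ denote the complex Green's function, i.e. the multivalued analytic function, unique up to a unimodular constant, for which $\log|\phi(\cdot,z_0,F)|$ is the Green's function of $\overline{\mathbb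 C}\setminus F$ with pole at $z_0$. Then $$\phi(z,\infty,E\cup I_n)=\frac{\phi(z,\infty,E)}{\prod_{k=1}^{m}\phi(z,c_k,E)^{\omega_{k,n}}}\Bigl(1+O\bigl(\max_{1\le k\le m}\omega_{k,n}^2\bigr)\Bigr)\qquad(n\to\infty)$$ uniformly on compact subsets of $\mathbb C\setminus(E\cup\{c_1,\dots,c_m\})$, in the following sense. For every compact $K\subset\mathbb C\setminus(E\cup\{c_1,\dots,c_m\})$ and every $\Lambda\ge0$ there are $M$ and $N$ such that for all $n\ge N$ and every rectifiable path $\gamma$ in $K$ of length at most $\Lambda$ the formula holds at the end point $z$ of $\gamma$ with an error factor $1+\varepsilon$, $|\varepsilon|\le M\max_k\omega_{k,n}^2$, when all the functions $\phi$ and their powers are continued analytically along $\gamma$ from positive values at the initial point of $\gamma$. (For constant $\gamma$ this is the formula for the moduli, uniformly in $z\in K$.) Moreover, $C_{k,n}-B_{k,n}=O\bigl(\max_{1\le \nu\le m}\omega_{\nu,n}^2\bigr)$ as $n\to\infty$ for every $k$. -/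

import Mathlib

open Set Filter Topology
open scoped NNReal

/-- The union `⋃ k, [a k, b k]` of finitely many closed real intervals, as a subset of `ℂ`. -/
def intervalUnion {l : ℕ} (a b : Fin l → ℝ) : Set ℂ :=
  ⋃ k, (fun x : ℝ => (x : ℂ)) '' Icc (a k) (b k)

/-- `g` is the Green's function `g(·, ∞, K)` of `ℂ ∖ K` with pole at `∞`: it is harmonic on
`ℂ ∖ K`, `g z - log |z|` has a finite limit at `∞`, and `g` vanishes at the boundary `K`.
The values of `g` on `K` itself are irrelevant. -/
structure IsGreenAtInfty (K : Set ℂ) (g : ℂ → ℝ) : Prop where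
  harmonic : InnerProductSpace.HarmonicOnNhd g Kᶜ
  pole : ∃ r : ℝ, Tendsto (fun z => g z - Real.log ‖z‖) (cocompact ℂ) (𝓝 r)
  boundary : ∀ x ∈ K, Tendsto g (𝓝[Kᶜ] x) (𝓝 0)

/-- `g` is the Green's function `g(·, p, K)` of `(ℂ ∪ {∞}) ∖ K` with pole at the finite point `p`:
it is harmonic on `ℂ ∖ (K ∪ {p})` and at `∞`, `g z + log |z - p|` has a finite limit at `p`, and
`g` vanishes at the boundary `K`. The values of `g` on `K` and at `p` are irrelevant. -/
structure IsGreenAt (K : Set ℂ) (p : ℂ) (g : ℂ → ℝ) : Prop where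
  harmonic : InnerProductSpace.HarmonicOnNhd g (K ∪ {p})ᶜ
  infty : ∃ r : ℝ, Tendsto g (cocompact ℂ) (𝓝 r)
  pole : ∃ r : ℝ, Tendsto (fun z => g z + Real.log ‖z - p‖) (𝓝[≠] p) (𝓝 r)
  boundary : ∀ x ∈ K, Tendsto g (𝓝[Kᶜ] x) (𝓝 0)

/-- `w = ω(∞, A, K)`, the harmonic measure at `∞` of a part `A` of `K` (with `A` and `K ∖ A` both
closed) with respect to `(ℂ ∪ {∞}) ∖ K`: the value at `∞` of the function that is harmonic on
`ℂ ∖ K` and at `∞` with boundary values `1` on `A` and `0` on `K ∖ A`. -/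
def IsHarmonicMeasureAtInfty (K A : Set ℂ) (w : ℝ) : Prop :=
  ∃ u : ℂ → ℝ, InnerProductSpace.HarmonicOnNhd u Kᶜ ∧
    (∀ x ∈ A, Tendsto u (𝓝[Kᶜ] x) (𝓝 1)) ∧
    (∀ x ∈ K \ A, Tendsto u (𝓝[Kᶜ] x) (𝓝 0)) ∧
    Tendsto u (cocompact ℂ) (𝓝 w)

/-- `∂g/∂x - i ∂g/∂y`: the derivative of any local holomorphic function with real part `g`. -/
noncomputable def complexGradient (g : ℂ → ℝ) (z : ℂ) : ℂ :=
  (fderiv ℝ g z 1 : ℂ) - Complex.I * (fderiv ℝ g z Complex.I : ℂ)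

/-- Let `φ` be the multivalued analytic function with `log |φ| = g`. This is the value at `γ 1` of
the branch of `log φ` obtained by analytic continuation along `γ : [0, 1] → ℂ`, starting from the
real value at `γ 0` (so that `φ > 0` at the base point `γ 0`). -/
noncomputable def logBranch (g : ℂ → ℝ) (γ : ℝ → ℂ) : ℂ :=
  (g (γ 0) : ℂ) + ∫ t in (0 : ℝ)..1, complexGradient g (γ t) * deriv γ t

/-- The power `φ ^ s` of the multivalued complex Green's function `φ` with `log |φ| = g`,
continued analytically along `γ` from a positive value at `γ 0`. -/
noncomputable def complexGreenPow (g : ℂ → ℝ) (s : ℝ) (γ : ℝ → ℂ) : ℂ :=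
  Complex.exp ((s : ℂ) * logBranch g γ)

/-- The multivalued complex Green's function `φ` with `log |φ| = g`, continued analytically along
`γ` from a positive value at `γ 0`. -/
noncomputable def complexGreen (g : ℂ → ℝ) (γ : ℝ → ℂ) : ℂ :=
  Complex.exp (logBranch g γ)

/-!
For `E ⊆ ℝ` and intervals `I k` containing `c k`, let `u k` be the harmonic function with boundary
values `1` on `I k` and `0` on the rest of `E ∪ I`, so that `ω k = u k (∞)`. Let `Δ` be the length
of the longest interval `I k`. Three facts give the asymptotic formula.

* *Two approximations by the functions `u i`.* The difference `g - gI` of the Green's functions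
  with pole at `∞` vanishes on `E` and equals `g` on the intervals, where it is `g (c i) + O(Δ)`. By
  the maximum principle `g - gI = ∑ i, g (c i) * u i + O(Δ)`. The Green's function `gc k` has a pole
  in `I k`, but after `-log |z - c k|` is replaced by the equilibrium potential of `I k`, which is
  constant on `I k` and close to the logarithm elsewhere (`exists_interval_potential`), the same
  argument yields `gc k = ∑ i, Γ k i * u i + O(Δ)` away from `c k`, with `Γ k i = gc k (c i)` for
  `i ≠ k`.

* *Symmetry.* At infinity the second approximation says `gc k (∞) = ∑ i, Γ k i * ω i + O(Δ)`. Since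
  Green's functions are symmetric in their two arguments, `gc k (∞) = g (c k)` and `Γ` is a
  symmetric matrix, so `∑ k, ω k * gc k = ∑ i, (∑ k, Γ k i * ω k) * u i + O(Δ)` is
  `∑ i, g (c i) * u i + O(Δ) = g - gI + O(Δ)`. This is `exists_abs_green_sub_le`. The symmetry
  (`IsGreenAt.limit_eq`, `IsGreenAt.apply_eq`) is reduced by an inversion about a point of `E` to
  Green's functions of plane open sets. There, in `IsPlaneGreen.symm`, it is a form of Green's second
  identity with circle averages in place of the Laplacian. The averaging operator is symmetric by
  Fubini's theorem, so no regularity of the boundary or of level sets is required.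

* *Lengths.* Comparing the regularized Green's function `gc k` with `∑ i, u i` shows that the sum `W`
  of the harmonic measures is at least of the order of `1 / log (1 / Δ)`. So the lengths are smaller
  than every power of `W`, in particular `O(W ^ 2)`: `exists_length_le_mul_sq`.

Hence `gI - g + ∑ k, ω k * gc k` is a harmonic function of size `O(max ω k ^ 2)` near a given compact
set. The gradient estimate bounds its conjugate along paths of bounded length by the same order
(`norm_logBranch_le`), and exponentiation gives the formula.
-/

/-! ### Harmonic functions in the plane -/

open InnerProductSpace Metric in
lemma HarmonicAt.exists_analytic_re {f : ℂ → ℝ} {z : ℂ} (hf : HarmonicAt f z) :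
    ∃ F : ℂ → ℂ, AnalyticAt ℂ F z ∧ f =ᶠ[𝓝 z] fun w => (F w).re := by
  obtain ⟨r, hr, hs⟩ := Metric.isOpen_iff.1 (isOpen_setOfPred_harmonicAt f) z hf
  obtain ⟨F, hF, hFf⟩ := HarmonicOnNhd.exists_analyticOnNhd_ball_re_eq (fun y hy => hs hy)
  exact ⟨F, hF z (mem_ball_self hr),
    eventually_of_mem (ball_mem_nhds z hr) fun w hw => (hFf hw).symm⟩

open InnerProductSpace in
lemma HarmonicAt.comp_analyticAt {f : ℂ → ℝ} {φ : ℂ → ℂ} {z : ℂ} (hf : HarmonicAt f (φ z))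
    (hφ : AnalyticAt ℂ φ z) : HarmonicAt (fun w => f (φ w)) z := by
  obtain ⟨F, hF, hFf⟩ := HarmonicAt.exists_analytic_re hf
  have h : (fun w => f (φ w)) =ᶠ[𝓝 z] fun w => (F (φ w)).re :=
    hφ.continuousAt.eventually hFf
  rw [harmonicAt_congr_nhds h]
  exact (hF.comp hφ).harmonicAt_re

open InnerProductSpace in
lemma harmonicAt_log_norm_sub {z p : ℂ} (h : z ≠ p) :
    HarmonicAt (fun w => Real.log ‖w - p‖) z :=
  AnalyticAt.harmonicAt_log_norm (f := fun w => w - p) (by fun_prop) (sub_ne_zero.2 h)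

lemma complexGradient_re_eq_deriv {F : ℂ → ℂ} {f : ℂ → ℝ} {z : ℂ} (hF : DifferentiableAt ℂ F z)
    (h : f =ᶠ[𝓝 z] fun w => (F w).re) : complexGradient f z = deriv F z := by
  have h1 : HasFDerivAt (fun w => (F w).re)
      (Complex.reCLM.comp ((ContinuousLinearMap.toSpanSingleton ℂ (deriv F z)).restrictScalars ℝ))
      z := Complex.reCLM.hasFDerivAt.comp z (hF.hasDerivAt.hasFDerivAt.restrictScalars ℝ)
  rw [complexGradient, h.fderiv_eq, h1.fderiv]
  apply Complex.ext <;> simp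

/-- The gradient estimate for bounded harmonic functions. -/
lemma norm_complexGradient_le {f : ℂ → ℝ} {z : ℂ} {r M : ℝ} (hr : 0 < r)
    (hf : InnerProductSpace.HarmonicOnNhd f (Metric.ball z r))
    (hM : ∀ w ∈ Metric.ball z r, |f w| ≤ M) : ‖complexGradient f z‖ ≤ 18 * M / r := by
  obtain ⟨F, hF, hFf⟩ := hf.exists_analyticOnNhd_ball_re_eq
  have hz : z ∈ Metric.ball z r := Metric.mem_ball_self hr
  have heq : f =ᶠ[𝓝 z] fun w => (F w).re :=
    eventually_of_mem (Metric.ball_mem_nhds z hr) fun w hw => (hFf hw).symm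
  rw [complexGradient_re_eq_deriv (hF z hz).differentiableAt heq]
  -- it suffices to treat bounds `M' > M ≥ 0`, so that one can divide by the bound
  have key : ∀ M' > M, ‖deriv F z‖ ≤ 18 * M' / r := by
    intro M' hM'
    have hM'0 : 0 < M' := lt_of_le_of_lt ((abs_nonneg _).trans (hM z hz)) hM'
    -- `exp (F / M')` has modulus between `1 / e` and `e`
    set P : ℂ → ℂ := fun w => Complex.exp (F w / M') with hP
    have hre : ∀ w ∈ Metric.ball z r, |(F w / M').re| ≤ 1 := by
      intro w hw
      have : (F w / M').re = f w / M' := by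
        rw [Complex.div_ofReal_re]; congr 1; exact hFf hw
      rw [this, abs_div, abs_of_pos hM'0, div_le_one hM'0]
      exact (hM w hw).trans hM'.le
    have hPd : DifferentiableOn ℂ P (Metric.ball z r) := fun w hw =>
      ((hF w hw).differentiableAt.div_const _).cexp.differentiableWithinAt
    have hb : ∀ w ∈ Metric.sphere z (r / 2), ‖P w‖ ≤ Real.exp 1 := by
      intro w hw
      rw [hP, Complex.norm_exp]
      refine Real.exp_le_exp.2 ((abs_le.1 (hre w ?_)).2)
      rw [Metric.mem_sphere] at hw
      rw [Metric.mem_ball]; linarith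
    have hd : ‖deriv P z‖ ≤ Real.exp 1 / (r / 2) :=
      Complex.norm_deriv_le_of_forall_mem_sphere_norm_le (by linarith)
        (hPd.diffContOnCl_ball
          (fun w hw => Metric.closedBall_subset_ball (by linarith) hw)) hb
    have hder : deriv P z = P z * (deriv F z / M') :=
      (((hF z hz).differentiableAt.hasDerivAt.div_const (M' : ℂ)).cexp).deriv
    have hlow : Real.exp (-1) ≤ ‖P z‖ := by
      rw [hP, Complex.norm_exp]
      exact Real.exp_le_exp.2 (abs_le.1 (hre z hz)).1
    rw [hder, norm_mul, norm_div, Complex.norm_real, Real.norm_eq_abs, abs_of_pos hM'0] at hd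
    have h1 : Real.exp (-1) * (‖deriv F z‖ / M') ≤ Real.exp 1 / (r / 2) :=
      (mul_le_mul_of_nonneg_right hlow (by positivity)).trans hd
    have h2 : ‖deriv F z‖ / M' ≤ Real.exp 1 * (Real.exp 1 / (r / 2)) := by
      have := mul_le_mul_of_nonneg_left h1 (Real.exp_pos 1).le
      rwa [← mul_assoc, ← Real.exp_add, add_neg_cancel, Real.exp_zero, one_mul] at this
    have h3 : Real.exp 1 * Real.exp 1 ≤ 9 := by
      nlinarith [Real.exp_one_lt_d9, Real.exp_pos 1]
    rw [div_le_iff₀ hM'0] at h2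
    calc ‖deriv F z‖ ≤ Real.exp 1 * (Real.exp 1 / (r / 2)) * M' := h2
      _ = (Real.exp 1 * Real.exp 1) * (2 * M' / r) := by ring
      _ ≤ 9 * (2 * M' / r) := by gcongr
      _ = 18 * M' / r := by ring
  refine le_of_forall_pos_le_add fun η hη => ?_
  have := key (M + η * r / 18) (by have : 0 < η * r / 18 := by positivity
                                   linarith)
  calc _ ≤ _ := this
    _ = 18 * M / r + η := by field_simp

open InnerProductSpace in
lemma HarmonicAt.differentiableAt_complexGradient {f : ℂ → ℝ} {z : ℂ} (hf : HarmonicAt f z) :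
    DifferentiableAt ℂ (complexGradient f) z :=
  _root_.HarmonicAt.differentiableAt_complex_partial hf

/-- Removable singularities of harmonic functions: the complex gradient is `o (1 / (z - c))` by the
gradient estimate, so that it extends holomorphically and has a primitive near `c`. -/
lemma harmonicAt_update_of_tendsto {f : ℂ → ℝ} {c : ℂ} {L : ℝ}
    (hf : ∀ᶠ z in 𝓝[≠] c, InnerProductSpace.HarmonicAt f z) (hL : Tendsto f (𝓝[≠] c) (𝓝 L)) :
    InnerProductSpace.HarmonicAt (Function.update f c L) c := by
  obtain ⟨r, hr, hball⟩ : ∃ r > 0, ∀ z, z ≠ c → dist z c < r →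
      InnerProductSpace.HarmonicAt f z := by
    rw [eventually_nhdsWithin_iff, Metric.eventually_nhds_iff] at hf
    obtain ⟨r, hr, h⟩ := hf
    exact ⟨r, hr, fun z hz hd => h hd hz⟩
  have hGd : DifferentiableOn ℂ (complexGradient f) (Metric.ball c r \ {c}) := fun z hz =>
    (HarmonicAt.differentiableAt_complexGradient (hball z hz.2 hz.1)).differentiableWithinAt
  -- the gradient estimate on the largest disc around `z` that avoids `c`
  have hbound : ∀ η > 0, ∀ᶠ z in 𝓝[≠] c, ‖complexGradient f z‖ ≤ η * ‖(z - c)⁻¹‖ := by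
    intro η hη
    have h1 : ∀ᶠ z in 𝓝[≠] c, |f z - L| ≤ η / 18 := by
      have := (Metric.tendsto_nhds.1 hL) (η / 18) (by positivity)
      filter_upwards [this] with z hz
      rw [Real.dist_eq] at hz; exact hz.le
    rw [eventually_nhdsWithin_iff, Metric.eventually_nhds_iff] at h1
    obtain ⟨s, hs, h1⟩ := h1
    rw [eventually_nhdsWithin_iff, Metric.eventually_nhds_iff]
    refine ⟨min (r / 2) (s / 2), by positivity, fun z hz hzc => ?_⟩
    have hd : 0 < dist z c := dist_pos.2 hzc
    have hsub : ∀ w ∈ Metric.ball z (dist z c), w ≠ c ∧ dist w c < r ∧ dist w c < s := by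
      intro w hw
      rw [Metric.mem_ball] at hw
      have h2 := dist_triangle w z c
      have h3 := lt_min_iff.1 hz
      refine ⟨?_, by linarith, by linarith⟩
      rintro rfl
      rw [dist_comm] at hw; exact lt_irrefl _ hw
    have h4 := norm_complexGradient_le (f := fun w => f w - L) (M := η / 18) hd
      (fun w hw => (hball w (hsub w hw).1 (hsub w hw).2.1).sub
        (InnerProductSpace.harmonicAt_const L))
      (fun w hw => h1 (hsub w hw).2.2 (hsub w hw).1)
    have h5 : complexGradient (fun w => f w - L) z = complexGradient f z := by
      have h6 : fderiv ℝ (fun w => f w - L) z = fderiv ℝ f z := fderiv_sub_const L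
      rw [complexGradient, h6, complexGradient]
    rw [h5] at h4
    calc _ ≤ _ := h4
      _ = η * ‖(z - c)⁻¹‖ := by
        rw [norm_inv, ← dist_eq_norm]; ring
  have ho : (fun z => complexGradient f z - complexGradient f c) =o[𝓝[≠] c]
      fun z => (z - c)⁻¹ := by
    refine Asymptotics.IsLittleO.sub (Asymptotics.isLittleO_iff.2 fun η hη => hbound η hη) ?_
    rw [Asymptotics.isLittleO_const_left]
    right
    have : Tendsto (fun z : ℂ => z - c) (𝓝[≠] c) (𝓝[≠] 0) := by
      refine tendsto_nhdsWithin_iff.2 ⟨?_, ?_⟩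
      · have : Tendsto (fun z : ℂ => z - c) (𝓝 c) (𝓝 (c - c)) := by
          exact (continuous_id.sub continuous_const).tendsto c
        rw [sub_self] at this
        exact this.mono_left nhdsWithin_le_nhds
      · filter_upwards [self_mem_nhdsWithin] with z hz
        exact sub_ne_zero.2 hz
    exact (tendsto_norm_cobounded_atTop.comp (tendsto_inv₀_nhdsNE_zero.comp this))
  have hext := Complex.differentiableOn_update_limUnder_of_isLittleO
    (Metric.ball_mem_nhds c hr) hGd ho
  obtain ⟨Φ, hΦ⟩ := hext.isExactOn_ball
  -- `f - Re Φ` is constant along each segment ending at `c`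
  set v : ℂ → ℝ := fun z => Function.update f c L z - (Φ z).re with hv
  have hfc : ∀ z, z ≠ c → Function.update f c L =ᶠ[𝓝 z] f := fun z hz => by
    filter_upwards [isOpen_ne.mem_nhds hz] with w hw
    exact Function.update_of_ne hw _ _
  have hcont : ∀ z ∈ Metric.ball c r, ContinuousAt v z := by
    intro z hz
    refine ContinuousAt.sub ?_ (Complex.continuous_re.continuousAt.comp (hΦ z hz).continuousAt)
    by_cases hzc : z = c
    · subst hzc
      exact continuousAt_update_same.2 hL
    · exact ((hball z hzc hz).1.continuousAt).congr (hfc z hzc).symm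
  have hderiv : ∀ z ∈ Metric.ball c r, z ≠ c → HasFDerivAt v (0 : ℂ →L[ℝ] ℝ) z := by
    intro z hz hzc
    obtain ⟨F, hF, hFf⟩ := HarmonicAt.exists_analytic_re (hball z hzc hz)
    have h1 : complexGradient f z = deriv F z :=
      complexGradient_re_eq_deriv hF.differentiableAt hFf
    have h2 : HasDerivAt Φ (deriv F z) z := by
      have := hΦ z hz
      rwa [Function.update_of_ne hzc, h1] at this
    have h3 : HasDerivAt (fun w => F w - Φ w) 0 z := by
      have := hF.differentiableAt.hasDerivAt.sub h2
      rwa [sub_self] at this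
    have h4 : HasFDerivAt (fun w => (F w - Φ w).re) (0 : ℂ →L[ℝ] ℝ) z := by
      have h5 := Complex.reCLM.hasFDerivAt.comp z (h3.hasFDerivAt.restrictScalars ℝ)
      have h6 : Complex.reCLM.comp ((ContinuousLinearMap.toSpanSingleton ℂ (0 : ℂ)).restrictScalars ℝ)
          = 0 := by ext; simp
      rw [h6] at h5
      exact h5
    refine h4.congr_of_eventuallyEq ?_
    filter_upwards [hFf, hfc z hzc] with w hw1 hw2
    simp [hv, hw1, hw2]
  have hconst : ∀ z ∈ Metric.ball c r, v z = v c := by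
    intro z hz
    by_cases hzc : z = c
    · rw [hzc]
    have hmem : ∀ t ∈ Icc (0 : ℝ) 1, c + t * (z - c) ∈ Metric.ball c r := by
      intro t ht
      rw [Metric.mem_ball, dist_eq_norm, add_sub_cancel_left, norm_mul, Complex.norm_real,
        Real.norm_eq_abs, abs_of_nonneg ht.1]
      rw [Metric.mem_ball, dist_eq_norm] at hz
      nlinarith [norm_nonneg (z - c), ht.2]
    have hd : ∀ t ∈ Ioo (0 : ℝ) 1, HasDerivAt (fun t : ℝ => v (c + t * (z - c))) 0 t := by
      intro t ht
      have hne : c + t * (z - c) ≠ c := by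
        simp [sub_ne_zero.2 hzc, ht.1.ne']
      have h1 := hderiv _ (hmem t ⟨ht.1.le, ht.2.le⟩) hne
      have h2 : HasDerivAt (fun t : ℝ => c + (t : ℂ) * (z - c)) (1 * (z - c)) t :=
        ((Complex.ofRealCLM.hasDerivAt (x := t)).mul_const (z - c)).const_add c
      have h3 := h1.comp_hasDerivAt t h2
      rw [zero_apply] at h3
      exact h3
    obtain ⟨ξ, hξ, h⟩ := exists_hasDerivAt_eq_slope
      (fun t : ℝ => v (c + t * (z - c))) (fun _ => 0) (zero_lt_one)
      (fun t ht => ((hcont _ (hmem t ht)).comp (f := fun t : ℝ => c + (t : ℂ) * (z - c))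
        (by fun_prop)).continuousWithinAt) hd
    simp at h
    linarith
  have hΦa : AnalyticAt ℂ Φ c :=
    DifferentiableOn.analyticAt (s := Metric.ball c r)
      (fun z hz => (hΦ z hz).differentiableAt.differentiableWithinAt)
      (Metric.ball_mem_nhds c hr)
  have : Function.update f c L =ᶠ[𝓝 c] fun z => (Φ z + (v c : ℂ)).re := by
    filter_upwards [Metric.ball_mem_nhds c hr] with z hz
    have := hconst z hz
    simp only [hv] at this ⊢
    simp only [Complex.add_re, Complex.ofReal_re]
    linarith
  rw [InnerProductSpace.harmonicAt_congr_nhds this]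
  exact (hΦa.add analyticAt_const).harmonicAt_re

open InnerProductSpace in
lemma HarmonicAt.eventually_eq_of_isLocalMax {f : ℂ → ℝ} {z : ℂ} (hf : HarmonicAt f z)
    (hm : IsLocalMax f z) : ∀ᶠ w in 𝓝 z, f w = f z := by
  obtain ⟨F, hF, hFf⟩ := HarmonicAt.exists_analytic_re hf
  have h1 : ∀ᶠ w in 𝓝 z, DifferentiableAt ℂ (fun w => Complex.exp (F w)) w := by
    filter_upwards [hF.eventually_analyticAt] with w hw
    exact hw.differentiableAt.cexp
  have h2 : IsLocalMax (norm ∘ fun w => Complex.exp (F w)) z := by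
    filter_upwards [hFf, hm] with w hw hw2
    simp only [Function.comp, Complex.norm_exp]
    have hz : f z = (F z).re := hFf.self_of_nhds
    rw [Real.exp_le_exp, ← hw, ← hz]
    exact hw2
  filter_upwards [Complex.eventually_eq_of_isLocalMax_norm h1 h2, hFf] with w hw hw2
  have := congrArg norm hw
  rw [Complex.norm_exp, Complex.norm_exp, Real.exp_eq_exp] at this
  have hz : f z = (F z).re := hFf.self_of_nhds
  rw [hw2, hz, this]

open InnerProductSpace in
lemma HarmonicAt.eventually_eq_of_isLocalMin {f : ℂ → ℝ} {z : ℂ} (hf : HarmonicAt f z)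
    (hm : IsLocalMin f z) : ∀ᶠ w in 𝓝 z, f w = f z := by
  have := HarmonicAt.eventually_eq_of_isLocalMax hf.neg hm.neg
  filter_upwards [this] with w hw
  simpa using hw

/-- The maximum principle, in the form that a superlevel set cannot be compact unless it is empty:
the set of maximum points would be open and compact in `ℂ`. -/
lemma superlevel_eq_empty_of_isCompact {u : ℂ → ℝ} {O : Set ℂ} (hO : IsOpen O)
    (hu : InnerProductSpace.HarmonicOnNhd u O) {s : ℝ} (hc : IsCompact {z ∈ O | s ≤ u z}) :
    {z ∈ O | s ≤ u z} = ∅ := by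
  by_contra hne
  have hcont : ContinuousOn u O := fun z hz => (hu z hz).1.continuousAt.continuousWithinAt
  obtain ⟨z₀, hz₀, hmax⟩ := hc.exists_isMaxOn (nonempty_iff_ne_empty.2 hne)
    (hcont.mono fun z hz => hz.1)
  have hle : ∀ z ∈ O, u z ≤ u z₀ := by
    intro z hz
    rcases le_total s (u z) with h | h
    · exact hmax ⟨hz, h⟩
    · exact h.trans hz₀.2
  set S : Set ℂ := {z ∈ O | u z₀ ≤ u z} with hS
  have hSeq : S = {z ∈ O | s ≤ u z} ∩ {z | z ∈ O → u z₀ ≤ u z} := by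
    ext z
    constructor
    · exact fun h => ⟨⟨h.1, hz₀.2.trans h.2⟩, fun _ => h.2⟩
    · exact fun h => ⟨h.1.1, h.2 h.1.1⟩
  have hSclosed : IsClosed S := by
    have h1 : ContinuousOn u {z ∈ O | s ≤ u z} := hcont.mono fun z hz => hz.1
    have h2 := h1.preimage_isClosed_of_isClosed hc.isClosed (isClosed_Ici (a := u z₀))
    convert h2 using 1
    rw [hSeq]
    ext z
    constructor
    · exact fun h => ⟨h.1, h.2 h.1.1⟩
    · exact fun h => ⟨h.1, fun _ => h.2⟩
  have hSopen : IsOpen S := by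
    rw [isOpen_iff_mem_nhds]
    intro z hz
    have hm : IsLocalMax u z := by
      filter_upwards [hO.mem_nhds hz.1] with w hw
      exact (hle w hw).trans hz.2
    filter_upwards [HarmonicAt.eventually_eq_of_isLocalMax (hu z hz.1) hm, hO.mem_nhds hz.1]
      with w hw hw2
    exact ⟨hw2, by rw [hw]; exact hz.2⟩
  have huniv : S = univ := IsClopen.eq_univ ⟨hSclosed, hSopen⟩ ⟨z₀, hz₀.1, le_rfl⟩
  have : IsCompact S := hc.of_isClosed_subset hSclosed (by rw [hSeq]; exact inter_subset_left)
  rw [huniv] at this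
  exact noncompact_univ ℂ this

/-! ### Circle averages as a symmetric operator -/

open MeasureTheory in
lemma continuous_circleAverage_center {f : ℂ → ℝ} (hf : Continuous f) (ε : ℝ) :
    Continuous fun z => Real.circleAverage f z ε := by
  have : Continuous fun x : ℂ × ℝ => circleMap x.1 ε x.2 := by
    simp only [circleMap]; fun_prop
  exact (intervalIntegral.continuous_parametric_intervalIntegral_of_continuous' (μ := volume)
    (f := fun z θ => f (circleMap z ε θ)) (hf.comp this) 0 (2 * Real.pi)).const_smul
      (2 * Real.pi)⁻¹

lemma circleAverage_eq_of_eqOn_closedBall {f u : ℂ → ℝ} {z : ℂ} {ε : ℝ} (hε : 0 < ε)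
    (hu : InnerProductSpace.HarmonicOnNhd u (Metric.closedBall z ε))
    (h : ∀ w ∈ Metric.sphere z ε, f w = u w) : Real.circleAverage f z ε = u z := by
  rw [← abs_of_pos hε] at hu h
  rw [Real.circleAverage_congr_sphere (f₂ := u) h, InnerProductSpace.HarmonicOnNhd.circleAverage_eq hu]

lemma hasCompactSupport_circleAverage {F : ℂ → ℝ} (hF : HasCompactSupport F) (ε : ℝ) :
    HasCompactSupport fun z => Real.circleAverage F z ε := by
  obtain ⟨R, hR⟩ := hF.isCompact.isBounded.subset_closedBall 0
  refine HasCompactSupport.intro (isCompact_closedBall (0 : ℂ) (R + |ε|)) fun z hz => ?_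
  refine Real.circleAverage_const_on_circle fun w hw => ?_
  by_contra hne
  have h1 := hR (subset_tsupport _ hne)
  rw [Metric.mem_closedBall] at h1 hz
  rw [Metric.mem_sphere, dist_comm] at hw
  linarith [dist_triangle z w 0]

open MeasureTheory in
/-- The operator of averaging over circles of a fixed radius is symmetric, by Fubini's theorem. -/
lemma integral_mul_circleAverage_comm {F H : ℂ → ℝ} (hF : Continuous F)
    (hFc : HasCompactSupport F) (hH : Continuous H) (ε : ℝ) :
    ∫ z, F z * Real.circleAverage H z ε = ∫ z, H z * Real.circleAverage F z ε := by
  have key : ∀ (F H : ℂ → ℝ), Continuous F → Continuous H →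
      (HasCompactSupport F ∨ HasCompactSupport H) → ∀ ε : ℝ,
      ∫ z, F z * Real.circleAverage H z ε =
      (2 * Real.pi)⁻¹ * ∫ θ in (0 : ℝ)..2 * Real.pi, ∫ z, F z * H (circleMap z ε θ) := by
    intro F H hF hH hc ε
    have hint : Integrable (Function.uncurry fun (z : ℂ) (θ : ℝ) => F z * H (circleMap z ε θ))
        (volume.prod (volume.restrict (Ioc 0 (2 * Real.pi)))) := by
      have hcont : Continuous
          (Function.uncurry fun (z : ℂ) (θ : ℝ) => F z * H (circleMap z ε θ)) := by
        have : Continuous fun x : ℂ × ℝ => circleMap x.1 ε x.2 := by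
          simp only [circleMap]; fun_prop
        exact (hF.comp continuous_fst).mul (hH.comp this)
      obtain ⟨S, hS, hSz⟩ : ∃ S : Set ℂ, IsCompact S ∧ ∀ z ∉ S, ∀ θ,
          F z * H (circleMap z ε θ) = 0 := by
        rcases hc with hc | hc
        · exact ⟨tsupport F, hc, fun z hz θ => by rw [image_eq_zero_of_notMem_tsupport hz, zero_mul]⟩
        · obtain ⟨R, hR⟩ := hc.isCompact.isBounded.subset_closedBall 0
          refine ⟨Metric.closedBall 0 (R + |ε|), isCompact_closedBall _ _, fun z hz θ => ?_⟩
          have : circleMap z ε θ ∉ tsupport H := by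
            intro h
            have h1 := hR h
            have hw := circleMap_mem_sphere' z ε θ
            rw [Metric.mem_closedBall] at h1 hz
            rw [Metric.mem_sphere, dist_comm] at hw
            linarith [dist_triangle z (circleMap z ε θ) 0]
          rw [image_eq_zero_of_notMem_tsupport this, mul_zero]
      have h1 : IntegrableOn (Function.uncurry fun (z : ℂ) (θ : ℝ) => F z * H (circleMap z ε θ))
          (S ×ˢ Icc 0 (2 * Real.pi)) (volume.prod volume) :=
        hcont.continuousOn.integrableOn_compact (hS.prod isCompact_Icc)
      have h2 : IntegrableOn (Function.uncurry fun (z : ℂ) (θ : ℝ) => F z * H (circleMap z ε θ))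
          (univ ×ˢ Ioc 0 (2 * Real.pi)) (volume.prod volume) := by
        refine h1.of_forall_sdiff_eq_zero
          (MeasurableSet.univ.prod measurableSet_Ioc) fun x hx => ?_
        refine hSz x.1 (fun hx1 => hx.2 ⟨hx1, ?_⟩) x.2
        exact Ioc_subset_Icc_self hx.1.2
      rwa [IntegrableOn, ← Measure.prod_restrict, Measure.restrict_univ] at h2
    have hswap := integral_integral_swap hint
    simp only [Real.circleAverage, smul_eq_mul,
      intervalIntegral.integral_of_le Real.two_pi_pos.le]
    rw [← hswap, ← integral_const_mul]
    congr 1; ext z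
    rw [integral_const_mul]; ring
  have hneg : ∀ z, Real.circleAverage F z ε = Real.circleAverage F z (-ε) := fun z =>
    Real.circleAverage_neg_radius.symm
  simp only [hneg]
  rw [key F H hF hH (Or.inl hFc) ε, key H F hH hF (Or.inr hFc) (-ε)]
  congr 2; ext θ
  rw [← integral_add_right_eq_self (fun z => H z * F (circleMap z (-ε) θ)) (circleMap 0 ε θ)]
  congr 1; ext z
  have h1 : circleMap (z + circleMap 0 ε θ) (-ε) θ = z := by simp [circleMap]
  have h2 : z + circleMap 0 ε θ = circleMap z ε θ := by simp [circleMap]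
  rw [h1, h2, mul_comm]

open MeasureTheory in
lemma integral_circleAverage {F : ℂ → ℝ} (hF : Continuous F) (hFc : HasCompactSupport F) (ε : ℝ) :
    ∫ z, Real.circleAverage F z ε = ∫ z, F z := by
  have := integral_mul_circleAverage_comm hF hFc (H := fun _ => 1) continuous_const ε
  simpa [Real.circleAverage_const] using this.symm

/-! ### The truncated logarithm -/

/-- `log |z - p|`, replaced by the constant `log ρ` in the disc of radius `ρ` about `p`. -/
noncomputable def truncLog (ρ : ℝ) (p z : ℂ) : ℝ := Real.log (max ‖z - p‖ ρ)

/-- The difference between the average of `truncLog ρ p` over the circle of radius `ε` about `z` and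
its value at `z`. Up to a factor of order `ε ^ 2`, it is a mollification of the Laplacian of
`truncLog ρ p`, that is, of the uniform measure on the circle of radius `ρ` about `p`. -/
noncomputable def truncLogDefect (ρ ε : ℝ) (p z : ℂ) : ℝ :=
  Real.circleAverage (truncLog ρ p) z ε - truncLog ρ p z

lemma truncLog_of_le {ρ : ℝ} {p z : ℂ} (h : ρ ≤ ‖z - p‖) :
    truncLog ρ p z = Real.log ‖z - p‖ := by rw [truncLog, max_eq_left h]

lemma truncLog_of_ge {ρ : ℝ} {p z : ℂ} (h : ‖z - p‖ ≤ ρ) :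
    truncLog ρ p z = Real.log ρ := by rw [truncLog, max_eq_right h]

lemma continuous_truncLog {ρ : ℝ} (hρ : 0 < ρ) (p : ℂ) : Continuous (truncLog ρ p) := by
  unfold truncLog
  refine Continuous.log (by fun_prop) fun z => ?_
  exact (lt_of_lt_of_le hρ (le_max_right _ _)).ne'

lemma log_le_truncLog {ρ : ℝ} {p z : ℂ} (hz : z ≠ p) :
    Real.log ‖z - p‖ ≤ truncLog ρ p z :=
  Real.log_le_log (norm_pos_iff.2 (sub_ne_zero.2 hz)) (le_max_left _ _)

lemma log_le_truncLog' {ρ : ℝ} (hρ : 0 < ρ) (p z : ℂ) : Real.log ρ ≤ truncLog ρ p z :=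
  Real.log_le_log hρ (le_max_right _ _)

lemma truncLog_le {ρ R : ℝ} (hρ : 0 < ρ) (hR : ρ ≤ R) {p z : ℂ} (hz : ‖z - p‖ ≤ R) :
    truncLog ρ p z ≤ Real.log R :=
  Real.log_le_log (lt_of_lt_of_le hρ (le_max_right _ _)) (max_le hz hR)

lemma continuous_truncLogDefect {ρ : ℝ} (hρ : 0 < ρ) (ε : ℝ) (p : ℂ) :
    Continuous (truncLogDefect ρ ε p) :=
  (continuous_circleAverage_center (continuous_truncLog hρ p) ε).sub (continuous_truncLog hρ p)

lemma truncLogDefect_eq_zero {ρ ε : ℝ} (hε : 0 < ε) (hρ : 0 < ρ) {p z : ℂ}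
    (h : ρ + ε ≤ ‖z - p‖) : truncLogDefect ρ ε p z = 0 := by
  rw [truncLogDefect, truncLog_of_le (by linarith), sub_eq_zero]
  have hb : ∀ w ∈ Metric.closedBall z ε, ρ ≤ ‖w - p‖ := by
    intro w hw
    rw [Metric.mem_closedBall, dist_comm, dist_eq_norm] at hw
    have : ‖z - p‖ ≤ ‖z - w‖ + ‖w - p‖ := norm_sub_le_norm_sub_add_norm_sub _ _ _
    linarith
  refine circleAverage_eq_of_eqOn_closedBall (u := fun w => Real.log ‖w - p‖) hε
    (fun w hw => harmonicAt_log_norm_sub ?_) fun w hw => ?_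
  · rintro rfl
    have := hb w hw
    rw [sub_self, norm_zero] at this; linarith
  · exact truncLog_of_le (hb w (Metric.sphere_subset_closedBall hw))

lemma truncLogDefect_nonneg {ρ ε : ℝ} (hε : 0 < ε) (hρ : ε < ρ) (p z : ℂ) :
    0 ≤ truncLogDefect ρ ε p z := by
  have hρ0 := hε.trans hρ
  have hci : CircleIntegrable (truncLog ρ p) z ε :=
    (continuous_truncLog hρ0 p).continuousOn.circleIntegrable hε.le
  rw [truncLogDefect, sub_nonneg]
  rcases le_total ‖z - p‖ ρ with h | h
  · rw [truncLog_of_ge h, ← Real.circleAverage_const (Real.log ρ) z ε]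
    exact Real.circleAverage_mono (circleIntegrable_const _ _ _) hci
      fun w _ => log_le_truncLog' hρ0 p w
  · have hne : ∀ w ∈ Metric.closedBall z ε, w ≠ p := by
      rintro w hw rfl
      rw [Metric.mem_closedBall, dist_comm, dist_eq_norm] at hw
      linarith
    have hh : InnerProductSpace.HarmonicOnNhd (fun w => Real.log ‖w - p‖)
        (Metric.closedBall z ε) := fun w hw => harmonicAt_log_norm_sub (hne w hw)
    rw [truncLog_of_le h, ← circleAverage_eq_of_eqOn_closedBall hε hh fun w _ => rfl]
    refine Real.circleAverage_mono ?_ hci fun w hw => ?_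
    · exact (hh.continuousOn.mono Metric.sphere_subset_closedBall).circleIntegrable hε.le
    · rw [abs_of_pos hε] at hw
      exact log_le_truncLog (hne w (Metric.sphere_subset_closedBall hw))

lemma truncLogDefect_eq_sub (ρ ε : ℝ) (p z : ℂ) :
    truncLogDefect ρ ε p z = truncLogDefect ρ ε 0 (z - p) := by
  have h : ∀ w, truncLog ρ p w = truncLog ρ 0 (w - p) := fun w => by simp [truncLog]
  rw [truncLogDefect, truncLogDefect, ← h]
  congr 1
  rw [← Real.circleAverage_map_add_const, ← Real.circleAverage_map_add_const (c := z - p)]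
  congr 1; ext w
  rw [h]; congr 1; ring

lemma hasCompactSupport_truncLogDefect {ρ ε : ℝ} (hε : 0 < ε) (hρ : 0 < ρ) (p : ℂ) :
    HasCompactSupport (truncLogDefect ρ ε p) := by
  refine HasCompactSupport.intro (isCompact_closedBall p (ρ + ε)) fun z hz => ?_
  rw [Metric.mem_closedBall, dist_eq_norm, not_le] at hz
  exact truncLogDefect_eq_zero hε hρ hz.le

open MeasureTheory in
lemma integral_truncLogDefect_eq (ρ ε : ℝ) (p q : ℂ) :
    ∫ z, truncLogDefect ρ ε p z = ∫ z, truncLogDefect ρ ε q z := by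
  have h : ∀ p : ℂ, ∫ z, truncLogDefect ρ ε p z = ∫ z, truncLogDefect ρ ε 0 z := fun p => by
    rw [← integral_sub_right_eq_self (truncLogDefect ρ ε 0) p]
    exact integral_congr_ae (Eventually.of_forall fun z => truncLogDefect_eq_sub ρ ε p z)
  rw [h p, h q]

open MeasureTheory in
lemma integral_truncLogDefect_pos {ρ ε : ℝ} (hε : 0 < ε) (hρ : ε < ρ) (p : ℂ) :
    0 < ∫ z, truncLogDefect ρ ε p z := by
  have hρ0 := hε.trans hρ
  refine (continuous_truncLogDefect hρ0 ε p).integral_pos_of_hasCompactSupport_nonneg_nonzero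
    (x := p + ρ) (hasCompactSupport_truncLogDefect hε hρ0 p)
    (fun z => truncLogDefect_nonneg hε hρ p z) (ne_of_gt ?_)
  have hn : ‖p + ρ - p‖ = ρ := by
    rw [add_sub_cancel_left, Complex.norm_real, Real.norm_eq_abs, abs_of_pos hρ0]
  -- at a point of the circle of radius `ρ` the truncated logarithm attains its minimum
  rw [truncLogDefect, truncLog_of_ge hn.le,
    ← Real.circleAverage_const (Real.log ρ) (p + ρ) ε]
  have hc : Continuous fun θ => truncLog ρ p (circleMap (p + ρ) ε θ) :=
    (continuous_truncLog hρ0 p).comp (by fun_prop)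
  have h1 : 0 < ∫ θ in (0 : ℝ)..2 * Real.pi,
      (truncLog ρ p (circleMap (p + ρ) ε θ) - Real.log ρ) := by
    refine intervalIntegral.integral_pos Real.two_pi_pos
      (hc.sub continuous_const).continuousOn (fun θ _ => sub_nonneg.2 (log_le_truncLog' hρ0 _ _))
      ⟨0, ⟨le_rfl, Real.two_pi_pos.le⟩, ?_⟩
    have h2 : ‖circleMap (p + ρ) ε 0 - p‖ = ρ + ε := by
      have : circleMap (p + ρ) ε 0 - p = ((ρ + ε : ℝ) : ℂ) := by
        simp [circleMap]; ring
      rw [this, Complex.norm_real, Real.norm_eq_abs, abs_of_pos (by linarith)]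
    rw [truncLog_of_le (by linarith), h2, sub_pos]
    exact Real.log_lt_log hρ0 (by linarith)
  rw [intervalIntegral.integral_sub (hc.intervalIntegrable _ _) (by simp)] at h1
  rw [Real.circleAverage, Real.circleAverage, ← smul_sub, smul_eq_mul]
  have : 0 < (2 * Real.pi)⁻¹ := inv_pos.2 Real.two_pi_pos
  exact mul_pos this h1

open MeasureTheory in
lemma abs_integral_mul_sub_le {φ w : ℂ → ℝ} {c η : ℝ} (hφ : Continuous φ)
    (hw : Continuous w) (hwc : HasCompactSupport w) (hw0 : ∀ z, 0 ≤ w z)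
    (h : ∀ z, w z ≠ 0 → |φ z - c| ≤ η) :
    |(∫ z, φ z * w z) - c * ∫ z, w z| ≤ η * ∫ z, w z := by
  have hi : Integrable fun z => φ z * w z :=
    (hφ.mul hw).integrable_of_hasCompactSupport hwc.mul_left
  have hi2 : Integrable w := hw.integrable_of_hasCompactSupport hwc
  rw [← integral_const_mul, ← integral_sub hi (hi2.const_mul c), ← integral_const_mul]
  refine abs_integral_le_integral_abs.trans ?_
  refine integral_mono (hi.sub (hi2.const_mul c)).abs (hi2.const_mul η) fun z => ?_
  by_cases hz : w z = 0
  · simp [hz]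
  · simp only
    rw [← sub_mul, abs_mul, abs_of_nonneg (hw0 z)]
    exact mul_le_mul_of_nonneg_right (h z hz) (hw0 z)

/-! ### Symmetry of Green's functions -/

lemma isCompact_superlevel {u : ℂ → ℝ} {O : Set ℂ} {s : ℝ} (hu : ContinuousOn u O)
    (hb : ∀ x, x ∉ O → ∀ᶠ z in 𝓝[O] x, u z < s)
    (hinf : ∀ᶠ z in cocompact ℂ ⊓ 𝓟 O, u z < s) : IsCompact {z ∈ O | s ≤ u z} := by
  have hclosed : IsClosed {z ∈ O | s ≤ u z} := by
    rw [← isOpen_compl_iff, isOpen_iff_mem_nhds]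
    intro x hx
    have h1 : ∀ᶠ z in 𝓝[O] x, u z < s := by
      by_cases hxO : x ∈ O
      · have : u x < s := not_le.1 fun h => hx ⟨hxO, h⟩
        exact (hu x hxO).eventually_lt_const this
      · exact hb x hxO
    filter_upwards [eventually_nhdsWithin_iff.1 h1] with z hz h
    exact absurd (hz h.1) (not_lt.2 h.2)
  rw [eventually_inf_principal] at hinf
  obtain ⟨S, hS, hSs⟩ := mem_cocompact.1 hinf
  refine hS.of_isClosed_subset hclosed fun z hz => ?_
  by_contra hzS
  exact absurd (hSs hzS hz.1) (not_lt.2 hz.2)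

/-- `f` is the Green's function with pole at `p` of the open set `Kᶜ ⊆ ℂ`, where the point `∞` is
part of the boundary: `f` vanishes there as well (the condition is void if `Kᶜ` is bounded). -/
structure IsPlaneGreen (K : Set ℂ) (p : ℂ) (f : ℂ → ℝ) : Prop where
  harmonic : InnerProductSpace.HarmonicOnNhd f (K ∪ {p})ᶜ
  pole : ∃ r : ℝ, Tendsto (fun z => f z + Real.log ‖z - p‖) (𝓝[≠] p) (𝓝 r)
  boundary : ∀ x ∈ K, Tendsto f (𝓝[Kᶜ] x) (𝓝 0)
  infty : Tendsto f (cocompact ℂ ⊓ 𝓟 Kᶜ) (𝓝 0)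

lemma isOpen_compl_union_singleton {K : Set ℂ} (hK : IsClosed K) (p : ℂ) :
    IsOpen (K ∪ {p})ᶜ := (hK.union isClosed_singleton).isOpen_compl

lemma eventually_mem_compl_union_singleton {K : Set ℂ} {p : ℂ} (hK : IsClosed K) (hp : p ∉ K) :
    ∀ᶠ z in 𝓝[≠] p, z ∈ (K ∪ {p})ᶜ := by
  filter_upwards [self_mem_nhdsWithin, nhdsWithin_le_nhds (hK.isOpen_compl.mem_nhds hp)]
    with z hz hz2 h
  rcases h with hK | hp
  · exact hz2 hK
  · exact hz hp

/-- A harmonic function with a logarithmic pole at `p` is `-log |z - p|` plus a function that is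
harmonic at `p`, too. -/
lemma exists_harmonic_eq_sub_log {K : Set ℂ} {p : ℂ} {f : ℂ → ℝ} (hK : IsClosed K) (hp : p ∉ K)
    (hf : InnerProductSpace.HarmonicOnNhd f (K ∪ {p})ᶜ)
    (hpole : ∃ r : ℝ, Tendsto (fun z => f z + Real.log ‖z - p‖) (𝓝[≠] p) (𝓝 r)) :
    ∃ φ : ℂ → ℝ, InnerProductSpace.HarmonicOnNhd φ Kᶜ ∧
      ∀ z, z ≠ p → f z = φ z - Real.log ‖z - p‖ := by
  obtain ⟨r, hr⟩ := hpole
  have hh : InnerProductSpace.HarmonicOnNhd (fun z => f z + Real.log ‖z - p‖) (K ∪ {p})ᶜ :=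
    fun z hz => (hf z hz).add (harmonicAt_log_norm_sub fun h => hz (Or.inr h))
  refine ⟨Function.update (fun z => f z + Real.log ‖z - p‖) p r, fun z hz => ?_, fun z hz => ?_⟩
  · by_cases hzp : z = p
    · subst hzp
      refine harmonicAt_update_of_tendsto ?_ hr
      filter_upwards [eventually_mem_compl_union_singleton hK hp] with w hw using hh w hw
    · have : Function.update (fun z => f z + Real.log ‖z - p‖) p r =ᶠ[𝓝 z]
          fun z => f z + Real.log ‖z - p‖ := by
        filter_upwards [isOpen_ne.mem_nhds hzp] with w hw using Function.update_of_ne hw _ _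
      rw [InnerProductSpace.harmonicAt_congr_nhds this]
      exact hh z (by simp [hzp]; exact hz)
  · rw [Function.update_of_ne hz]; ring

lemma tendsto_log_norm_sub (p : ℂ) :
    Tendsto (fun z => Real.log ‖z - p‖) (𝓝[≠] p) atBot := by
  refine Real.tendsto_log_nhdsGT_zero.comp (tendsto_nhdsWithin_iff.2 ⟨?_, ?_⟩)
  · have : Tendsto (fun z : ℂ => ‖z - p‖) (𝓝 p) (𝓝 ‖p - p‖) :=
      Continuous.tendsto (by fun_prop) p
    rw [sub_self, norm_zero] at this
    exact this.mono_left nhdsWithin_le_nhds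
  · filter_upwards [self_mem_nhdsWithin] with z hz
    exact norm_pos_iff.2 (sub_ne_zero.2 hz)

lemma tendsto_atTop_of_pole {p : ℂ} {f : ℂ → ℝ}
    (hpole : ∃ r : ℝ, Tendsto (fun z => f z + Real.log ‖z - p‖) (𝓝[≠] p) (𝓝 r)) :
    Tendsto f (𝓝[≠] p) atTop := by
  obtain ⟨r, hr⟩ := hpole
  have := hr.add_atTop (tendsto_neg_atBot_atTop.comp (tendsto_log_norm_sub p))
  refine this.congr fun z => ?_
  simp [Function.comp]

namespace IsPlaneGreen

variable {K : Set ℂ} {p : ℂ} {f : ℂ → ℝ}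

lemma nonneg (hf : IsPlaneGreen K p f) (hK : IsClosed K) (hp : p ∉ K) {z : ℂ} (hz : z ∉ K)
    (hzp : z ≠ p) : 0 ≤ f z := by
  by_contra hneg
  push Not at hneg
  set s := -f z / 2 with hs
  have hs0 : 0 < s := by rw [hs]; linarith
  have hsub : (K ∪ {p})ᶜ ⊆ Kᶜ := compl_subset_compl.2 subset_union_left
  have hcomp : IsCompact {w ∈ (K ∪ {p})ᶜ | s ≤ (-f) w} := by
    refine isCompact_superlevel
      (fun w hw => (hf.harmonic w hw).1.continuousAt.neg.continuousWithinAt) ?_ ?_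
    · intro x hx
      rw [notMem_compl_iff] at hx
      rcases hx with hx | hx
      · have h1 := ((hf.boundary x hx).mono_left (nhdsWithin_mono x hsub)).neg
        rw [neg_zero] at h1
        exact h1.eventually_lt_const hs0
      · rw [mem_singleton_iff] at hx
        subst hx
        have h1 : Tendsto f (𝓝[(K ∪ {x})ᶜ] x) atTop :=
          (tendsto_atTop_of_pole hf.pole).mono_left
            (nhdsWithin_mono x (compl_subset_compl.2 subset_union_right))
        filter_upwards [h1.eventually_gt_atTop (-s)] with w hw
        simp only [Pi.neg_apply]; linarith
    · have h1 := (hf.infty.mono_left (inf_le_inf_left _ (principal_mono.2 hsub))).neg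
      rw [neg_zero] at h1
      exact h1.eventually_lt_const hs0
  have := superlevel_eq_empty_of_isCompact (isOpen_compl_union_singleton hK p) hf.harmonic.neg hcomp
  have hmem : z ∈ {w ∈ (K ∪ {p})ᶜ | s ≤ (-f) w} := by
    refine ⟨fun h => h.elim hz hzp, ?_⟩
    simp only [Pi.neg_apply, hs]; linarith
  rw [this] at hmem
  exact hmem

end IsPlaneGreen

/-- The function `φ - log |z - p|` on `Kᶜ`, with its logarithmic pole cut off at the circle of
radius `ρ` about `p`, and extended by `0` to `K`. -/
noncomputable def cutGreen (K : Set ℂ) (φ : ℂ → ℝ) (ρ : ℝ) (p : ℂ) : ℂ → ℝ :=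
  Kᶜ.indicator fun z => φ z - truncLog ρ p z

section cutGreen

variable {K : Set ℂ} {p : ℂ} {f φ : ℂ → ℝ} {ρ : ℝ}

lemma cutGreen_of_notMem {z : ℂ} (hz : z ∉ K) : cutGreen K φ ρ p z = φ z - truncLog ρ p z :=
  indicator_of_mem hz _

lemma cutGreen_of_mem {z : ℂ} (hz : z ∈ K) : cutGreen K φ ρ p z = 0 :=
  indicator_of_notMem (fun h : z ∈ Kᶜ => h hz) _

lemma cutGreen_eq (hφ : ∀ z, z ≠ p → f z = φ z - Real.log ‖z - p‖) (hρ : 0 < ρ) {z : ℂ}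
    (hz : z ∉ K) (hzp : ρ ≤ ‖z - p‖) : cutGreen K φ ρ p z = f z := by
  rw [cutGreen_of_notMem hz, truncLog_of_le hzp, hφ z]
  rintro rfl
  rw [sub_self, norm_zero] at hzp; linarith

lemma cutGreen_eventuallyEq (hφ : ∀ z, z ≠ p → f z = φ z - Real.log ‖z - p‖) (hρ : 0 < ρ)
    (hball : Metric.closedBall p ρ ⊆ Kᶜ) {x : ℂ} (hx : x ∈ K) :
    f =ᶠ[𝓝[Kᶜ] x] cutGreen K φ ρ p := by
  have : ∀ᶠ z in 𝓝 x, z ∉ Metric.closedBall p ρ :=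
    Metric.isClosed_closedBall.isOpen_compl.mem_nhds fun h => hball h hx
  filter_upwards [self_mem_nhdsWithin, nhdsWithin_le_nhds this] with z hz hz2
  rw [Metric.mem_closedBall, dist_eq_norm, not_le] at hz2
  exact (cutGreen_eq hφ hρ hz hz2.le).symm

lemma continuous_cutGreen (hf : IsPlaneGreen K p f) (hK : IsClosed K)
    (hφh : InnerProductSpace.HarmonicOnNhd φ Kᶜ)
    (hφ : ∀ z, z ≠ p → f z = φ z - Real.log ‖z - p‖) (hρ : 0 < ρ)
    (hball : Metric.closedBall p ρ ⊆ Kᶜ) : Continuous (cutGreen K φ ρ p) := by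
  rw [continuous_iff_continuousAt]
  intro x
  by_cases hx : x ∈ K
  · rw [ContinuousAt, cutGreen_of_mem hx, ← nhdsWithin_univ, ← union_compl_self K,
      nhdsWithin_union, tendsto_sup]
    refine ⟨?_, (hf.boundary x hx).congr' (cutGreen_eventuallyEq hφ hρ hball hx)⟩
    refine tendsto_const_nhds.congr' ?_
    filter_upwards [self_mem_nhdsWithin] with z hz
    exact (cutGreen_of_mem hz).symm
  · have h1 : ContinuousAt (fun z => φ z - truncLog ρ p z) x :=
      (hφh x hx).1.continuousAt.sub (continuous_truncLog hρ p).continuousAt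
    refine h1.congr ?_
    filter_upwards [hK.isOpen_compl.mem_nhds hx] with z hz using (cutGreen_of_notMem hz).symm

lemma tendsto_cutGreen_cocompact (hf : IsPlaneGreen K p f)
    (hφ : ∀ z, z ≠ p → f z = φ z - Real.log ‖z - p‖) (hρ : 0 < ρ) :
    Tendsto (cutGreen K φ ρ p) (cocompact ℂ) (𝓝 0) := by
  have h1 := hf.infty
  rw [Metric.tendsto_nhds] at h1 ⊢
  intro η hη
  filter_upwards [eventually_inf_principal.1 (h1 η hη),
    (isCompact_closedBall p ρ).compl_mem_cocompact] with z hz hz2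
  by_cases hzK : z ∈ K
  · rw [cutGreen_of_mem hzK, dist_self]; exact hη
  · rw [mem_compl_iff, Metric.mem_closedBall, dist_eq_norm, not_le] at hz2
    rw [cutGreen_eq hφ hρ hzK hz2.le]
    exact hz hzK

lemma circleAverage_cutGreen (hφh : InnerProductSpace.HarmonicOnNhd φ Kᶜ) (hρ : 0 < ρ)
    {z : ℂ} {ε : ℝ} (hε : 0 < ε) (hball : Metric.closedBall z ε ⊆ Kᶜ) :
    Real.circleAverage (cutGreen K φ ρ p) z ε =
      cutGreen K φ ρ p z - truncLogDefect ρ ε p z := by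
  have h1 : Real.circleAverage (cutGreen K φ ρ p) z ε =
      Real.circleAverage (fun w => φ w - truncLog ρ p w) z ε := by
    refine Real.circleAverage_congr_sphere fun w hw => ?_
    rw [abs_of_pos hε] at hw
    exact cutGreen_of_notMem (hball (Metric.sphere_subset_closedBall hw))
  rw [h1, Real.circleAverage_fun_sub, cutGreen_of_notMem
    (hball (Metric.mem_closedBall_self hε.le)), truncLogDefect,
    circleAverage_eq_of_eqOn_closedBall hε (fun w hw => hφh w (hball hw)) fun w _ => rfl]
  · ring
  · have : ContinuousOn φ (Metric.sphere z ε) := fun w hw =>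
      (hφh w (hball (Metric.sphere_subset_closedBall hw))).1.continuousAt.continuousWithinAt
    exact this.circleIntegrable hε.le
  · exact (continuous_truncLog hρ p).continuousOn.circleIntegrable hε.le

end cutGreen

/-- Where the Green's function `f` is small but positive, `h` is small: on the compact set where
`h` is large, `f` is bounded below near each of its points, or vanishes identically there. -/
lemma IsPlaneGreen.exists_small {K : Set ℂ} {p q : ℂ} {f h : ℂ → ℝ} (hK : IsClosed K) (hp : p ∉ K)
    (hq : q ∉ K) (hf : IsPlaneGreen K p f) (hh : IsPlaneGreen K q h) {r η : ℝ} (hr : 0 < r)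
    (hη : 0 < η) (hball : Metric.closedBall q r ⊆ Kᶜ) :
    ∃ τ > 0, ∀ w, w ∉ K → w ≠ p → 0 < f w → f w < τ → |h w| ≤ η ∧ r ≤ ‖w - q‖ := by
  obtain ⟨ψ, hψh, hψ⟩ := exists_harmonic_eq_sub_log hK hq hh.harmonic hh.pole
  have hHc := continuous_cutGreen hh hK hψh hψ hr hball
  have hHi := tendsto_cutGreen_cocompact hh hψ hr
  set H := cutGreen K ψ r q with hH
  have hHcomp : IsCompact {z ∈ (univ : Set ℂ) | η ≤ |H z|} := by
    refine isCompact_superlevel hHc.abs.continuousOn (fun x hx => absurd (mem_univ x) hx) ?_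
    have := hHi.abs
    rw [abs_zero] at this
    rw [principal_univ, inf_top_eq]
    exact this.eventually_lt_const hη
  set Q := {z ∈ (univ : Set ℂ) | η ≤ |H z|} ∪ Metric.closedBall q r with hQ
  have hQc : IsCompact Q := hHcomp.union (isCompact_closedBall q r)
  have hQK : ∀ z ∈ Q, z ∉ K := by
    rintro z (hz | hz) hzK
    · have h1 := hz.2
      rw [hH, cutGreen_of_mem hzK, abs_zero] at h1
      linarith
    · exact hball hz hzK
  obtain ⟨τ, hτ, hQτ⟩ : ∃ τ > 0, ∀ z ∈ Q, z ≠ p → 0 < f z → τ ≤ f z := by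
    refine hQc.induction_on (p := fun S => ∃ τ > 0, ∀ z ∈ S, z ≠ p → 0 < f z → τ ≤ f z)
      ⟨1, one_pos, fun z hz => absurd hz (notMem_empty z)⟩ ?_ ?_ ?_
    · rintro S T hST ⟨τ, hτ, h⟩
      exact ⟨τ, hτ, fun z hz => h z (hST hz)⟩
    · rintro S T ⟨τ, hτ, h⟩ ⟨τ', hτ', h'⟩
      refine ⟨min τ τ', lt_min hτ hτ', ?_⟩
      rintro z (hz | hz) hzp h0
      · exact (min_le_left _ _).trans (h z hz hzp h0)
      · exact (min_le_right _ _).trans (h' z hz hzp h0)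
    · intro x hx
      have hxK := hQK x hx
      by_cases hxp : x = p
      · subst hxp
        have h1 := (tendsto_atTop_of_pole hf.pole).eventually_ge_atTop 1
        rw [eventually_nhdsWithin_iff] at h1
        exact ⟨_, mem_nhdsWithin_of_mem_nhds h1, 1, one_pos, fun z hz hzp _ => hz hzp⟩
      · have hxm : x ∈ (K ∪ {p})ᶜ := fun h => h.elim hxK hxp
        rcases (hf.nonneg hK hp hxK hxp).eq_or_lt with h0 | h0
        · have hmin : IsLocalMin f x := by
            filter_upwards [(isOpen_compl_union_singleton hK p).mem_nhds hxm] with w hw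
            rw [← h0]
            exact hf.nonneg hK hp (fun h => hw (Or.inl h)) (fun h => hw (Or.inr h))
          have h1 := HarmonicAt.eventually_eq_of_isLocalMin (hf.harmonic x hxm) hmin
          refine ⟨_, mem_nhdsWithin_of_mem_nhds h1, 1, one_pos, fun z hz _ hz0 => ?_⟩
          have : f z = f x := hz
          rw [this, ← h0] at hz0
          exact absurd hz0 (lt_irrefl _)
        · have h1 : ∀ᶠ z in 𝓝 x, f x / 2 < f z :=
            (hf.harmonic x hxm).1.continuousAt.eventually_const_lt (by linarith)
          exact ⟨_, mem_nhdsWithin_of_mem_nhds h1, f x / 2, by linarith, fun z hz _ _ => le_of_lt hz⟩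
  refine ⟨τ, hτ, fun w hwK hwp hw0 hwτ => ?_⟩
  have hwQ : w ∉ Q := fun h => absurd (hQτ w h hwp hw0) (not_le.2 hwτ)
  have h1 : w ∉ Metric.closedBall q r := fun h => hwQ (Or.inr h)
  rw [Metric.mem_closedBall, dist_eq_norm, not_le] at h1
  refine ⟨?_, h1.le⟩
  by_contra hlt
  refine hwQ (Or.inl ⟨mem_univ _, ?_⟩)
  rw [hH, cutGreen_eq hψ hr hwK h1.le]
  exact (not_le.1 hlt).le

open MeasureTheory in
/-- Symmetry of Green's functions. Green's second identity is applied with the difference between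
circle averages of a small radius `ε` and values in place of the Laplacian, to the function `H`
that is `h` with its pole cut off, and to `F = (f - t)⁺`, `f` with its pole cut off. The level set
`f = t`, where `F` is not harmonic, contributes to the identity a positive measure of the same
total mass as the poles, and `h` is small there. -/
theorem IsPlaneGreen.symm {K : Set ℂ} {p q : ℂ} {f h : ℂ → ℝ} (hK : IsClosed K) (hp : p ∉ K)
    (hq : q ∉ K) (hpq : p ≠ q) (hf : IsPlaneGreen K p f) (hh : IsPlaneGreen K q h) :
    f q = h p := by
  suffices key : ∀ η > 0, |f q - h p| ≤ 5 * η by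
    have : |f q - h p| ≤ 0 := le_of_forall_pos_le_add fun η hη => by
      have := key (η / 5) (by positivity)
      linarith
    exact sub_eq_zero.1 (abs_nonpos_iff.1 this)
  intro η hη
  obtain ⟨φ, hφh, hφ⟩ := exists_harmonic_eq_sub_log hK hp hf.harmonic hf.pole
  obtain ⟨ψ, hψh, hψ⟩ := exists_harmonic_eq_sub_log hK hq hh.harmonic hh.pole
  have hqm : q ∈ (K ∪ {p})ᶜ := fun h => h.elim hq hpq.symm
  have hpm : p ∈ (K ∪ {q})ᶜ := fun h => h.elim hp hpq
  -- the radius `r` at which the poles are cut off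
  obtain ⟨r, hr, hrpq, hrp, hrq⟩ : ∃ r > 0, 4 * r < ‖p - q‖ ∧
      (∀ z ∈ Metric.closedBall p (2 * r), z ∈ (K ∪ {q})ᶜ ∧ |h z - h p| ≤ η ∧
        1 + Real.log (2 * r) ≤ φ z) ∧
      (∀ z ∈ Metric.closedBall q (2 * r), z ∈ (K ∪ {p})ᶜ ∧ |f z - f q| ≤ η) := by
    have h1 : ∀ᶠ z in 𝓝 p, z ∈ (K ∪ {q})ᶜ ∧ |h z - h p| ≤ η ∧ φ p - 1 < φ z := by
      filter_upwards [(isOpen_compl_union_singleton hK q).mem_nhds hpm,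
        (Metric.tendsto_nhds.1 (hh.harmonic p hpm).1.continuousAt) η hη,
        (hφh p hp).1.continuousAt.eventually_const_lt (show φ p - 1 < φ p by linarith)]
        with z h1 h2 h3
      rw [Real.dist_eq] at h2
      exact ⟨h1, h2.le, h3⟩
    have h2 : ∀ᶠ z in 𝓝 q, z ∈ (K ∪ {p})ᶜ ∧ |f z - f q| ≤ η := by
      filter_upwards [(isOpen_compl_union_singleton hK p).mem_nhds hqm,
        (Metric.tendsto_nhds.1 (hf.harmonic q hqm).1.continuousAt) η hη] with z h1 h2
      rw [Real.dist_eq] at h2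
      exact ⟨h1, h2.le⟩
    have hpq0 : 0 < ‖p - q‖ := norm_pos_iff.2 (sub_ne_zero.2 hpq)
    obtain ⟨r1, hr1, h1⟩ := Metric.eventually_nhds_iff.1 h1
    obtain ⟨r2, hr2, h2⟩ := Metric.eventually_nhds_iff.1 h2
    have h3 : ∀ᶠ r : ℝ in 𝓝[>] 0, Real.log (2 * r) ≤ φ p - 2 := by
      have : Tendsto (fun r : ℝ => 2 * r) (𝓝[>] 0) (𝓝[>] 0) := by
        refine tendsto_nhdsWithin_iff.2 ⟨?_, ?_⟩
        · have : Tendsto (fun r : ℝ => 2 * r) (𝓝 0) (𝓝 (2 * 0)) :=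
            Continuous.tendsto (by fun_prop) 0
          rw [mul_zero] at this
          exact this.mono_left nhdsWithin_le_nhds
        · filter_upwards [self_mem_nhdsWithin] with r hr
          exact mul_pos two_pos (mem_Ioi.1 hr)
      exact (Real.tendsto_log_nhdsGT_zero.comp this).eventually_le_atBot _
    have h4 : ∀ᶠ r : ℝ in 𝓝[>] 0, r < min (min r1 r2 / 2) (‖p - q‖ / 4) :=
      nhdsWithin_le_nhds (eventually_lt_nhds (lt_min (by positivity) (by linarith)))
    obtain ⟨r, ⟨h3, h4⟩, hr⟩ := ((h3.and h4).and self_mem_nhdsWithin).exists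
    obtain ⟨h4, h4'⟩ := lt_min_iff.1 h4
    have h5 : 2 * r < r1 := by linarith [min_le_left r1 r2]
    have h6 : 2 * r < r2 := by linarith [min_le_right r1 r2]
    refine ⟨r, hr, by linarith, fun z hz => ?_, fun z hz => ?_⟩
    · obtain ⟨h7, h8, h9⟩ := h1 (y := z) (lt_of_le_of_lt hz h5)
      exact ⟨h7, h8, by linarith⟩
    · exact h2 (lt_of_le_of_lt hz h6)
  have hrr : ∀ c : ℂ, Metric.closedBall c r ⊆ Metric.closedBall c (2 * r) := fun c =>
    Metric.closedBall_subset_closedBall (by linarith)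
  have hbp : Metric.closedBall p r ⊆ Kᶜ := fun z hz h => (hrp z (hrr p hz)).1 (Or.inl h)
  have hbq : Metric.closedBall q r ⊆ Kᶜ := fun z hz h => (hrq z (hrr q hz)).1 (Or.inl h)
  have hfar : ∀ z ∈ Metric.closedBall p (2 * r), r ≤ ‖z - q‖ := by
    intro z hz
    rw [Metric.mem_closedBall, dist_comm, dist_eq_norm] at hz
    have : ‖p - q‖ ≤ ‖p - z‖ + ‖z - q‖ := norm_sub_le_norm_sub_add_norm_sub _ _ _
    linarith
  have hfar' : ∀ z ∈ Metric.closedBall q (2 * r), r ≤ ‖z - p‖ := by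
    intro z hz
    rw [Metric.mem_closedBall, dist_eq_norm] at hz
    have : ‖p - q‖ ≤ ‖p - z‖ + ‖z - q‖ := norm_sub_le_norm_sub_add_norm_sub _ _ _
    rw [norm_sub_rev p z] at this
    linarith
  obtain ⟨τ, hτ, hsmall⟩ := hf.exists_small hK hp hq hh hr hη hbq
  -- the level `t`
  obtain ⟨t, ht, htτ, ht1, htη⟩ : ∃ t > 0, 2 * t < τ ∧ 2 * t < 1 ∧ t ≤ η := by
    refine ⟨min (τ / 3) (min (1 / 3) η), by positivity, ?_, ?_, ?_⟩
    · linarith [min_le_left (τ / 3) (min (1 / 3) η)]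
    · linarith [min_le_right (τ / 3) (min (1 / 3) η), min_le_left (1 / 3) η]
    · exact (min_le_right _ _).trans (min_le_right _ _)
  set G := cutGreen K φ r p with hG
  set H := cutGreen K ψ r q with hH
  have hGc : Continuous G := continuous_cutGreen hf hK hφh hφ hr hbp
  have hHc : Continuous H := continuous_cutGreen hh hK hψh hψ hr hbq
  have hGi : Tendsto G (cocompact ℂ) (𝓝 0) := tendsto_cutGreen_cocompact hf hφ hr
  have hHi : Tendsto H (cocompact ℂ) (𝓝 0) := tendsto_cutGreen_cocompact hh hψ hr
  -- near `p`, the function `G` exceeds the level `t`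
  have hG1 : ∀ z ∈ Metric.closedBall p (2 * r), 1 ≤ G z := by
    intro z hz
    rw [hG, cutGreen_of_notMem fun h => (hrp z hz).1 (Or.inl h)]
    have h1 := (hrp z hz).2.2
    rw [Metric.mem_closedBall, dist_eq_norm] at hz
    have h2 := truncLog_le hr (by linarith) hz
    linarith
  have hGH : ∀ z, t < G z → G z < 2 * t → |H z| ≤ η := by
    intro z hz hz2
    have hzK : z ∉ K := by
      intro h
      rw [hG, cutGreen_of_mem h] at hz
      linarith
    have hzp : z ∉ Metric.closedBall p (2 * r) := fun h => by linarith [hG1 z h]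
    rw [Metric.mem_closedBall, dist_eq_norm, not_le] at hzp
    rw [hG, cutGreen_eq hφ hr hzK (by linarith)] at hz hz2
    have hne : z ≠ p := by
      rintro rfl
      rw [sub_self, norm_zero] at hzp; linarith
    obtain ⟨h1, h2⟩ := hsmall z hzK hne (by linarith) (by linarith)
    rwa [hH, cutGreen_eq hψ hr hzK h2]
  set S := {z ∈ (univ : Set ℂ) | t ≤ G z} with hS
  have hSc : IsCompact S := by
    refine isCompact_superlevel hGc.continuousOn (fun x hx => absurd (mem_univ x) hx) ?_
    rw [principal_univ, inf_top_eq]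
    exact hGi.eventually_lt_const ht
  have hSK : S ⊆ Kᶜ := by
    intro z hz hzK
    have := hz.2
    rw [hG, cutGreen_of_mem hzK] at this
    linarith
  set F : ℂ → ℝ := fun z => max (G z - t) 0 with hF
  have hFc : Continuous F := (hGc.sub continuous_const).max continuous_const
  have hFS : ∀ z, F z ≠ 0 → z ∈ S := by
    intro z hz
    refine ⟨mem_univ z, ?_⟩
    by_contra hlt
    exact hz (max_eq_right (by linarith [not_le.1 hlt]))
  have hFs : HasCompactSupport F :=
    HasCompactSupport.intro hSc fun z hz => by
      by_contra hne
      exact hz (hFS z hne)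
  -- the radius `ε`
  obtain ⟨δ, hδ, hδS⟩ := hSc.exists_thickening_subset_open hK.isOpen_compl hSK
  obtain ⟨δ1, hδ1, hδF⟩ := Metric.uniformContinuous_iff.1
    (hFc.uniformContinuous_of_tendsto_cocompact
      (hFs.is_zero_at_infty)) t ht
  obtain ⟨δ2, hδ2, hδH⟩ := Metric.uniformContinuous_iff.1
    (hHc.uniformContinuous_of_tendsto_cocompact hHi) η hη
  obtain ⟨ε, hε, hεr, hεδ, hε1, hε2⟩ : ∃ ε > 0, 2 * ε < r ∧ 2 * ε < δ ∧ 2 * ε < δ1 ∧ ε < δ2 := by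
    refine ⟨min (min r δ) (min δ1 δ2) / 3, by positivity, ?_, ?_, ?_, ?_⟩
    · linarith [min_le_left (min r δ) (min δ1 δ2), min_le_left r δ]
    · linarith [min_le_left (min r δ) (min δ1 δ2), min_le_right r δ, hδ, hr]
    · linarith [min_le_right (min r δ) (min δ1 δ2), min_le_left δ1 δ2]
    · linarith [min_le_right (min r δ) (min δ1 δ2), min_le_right δ1 δ2]
  set A : (ℂ → ℝ) → ℂ → ℝ := fun u z => Real.circleAverage u z ε with hA
  set κ : ℂ → ℝ := fun z => A F z - F z + truncLogDefect r ε p z with hκ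
  have hAFc : Continuous (A F) := continuous_circleAverage_center hFc ε
  have hAFs : HasCompactSupport (A F) := hasCompactSupport_circleAverage hFs ε
  have hDc : ∀ c, Continuous (truncLogDefect r ε c) := fun c => continuous_truncLogDefect hr ε c
  have hDs : ∀ c, HasCompactSupport (truncLogDefect r ε c) :=
    fun c => hasCompactSupport_truncLogDefect hε hr c
  have hκc : Continuous κ := (hAFc.sub hFc).add (hDc p)
  have hκs : HasCompactSupport κ := (hAFs.sub hFs).add (hDs p)
  -- `κ` is the contribution of the level set `f = t`
  have hκ0 : ∀ z, 0 ≤ κ z ∧ (κ z ≠ 0 → |H z - 0| ≤ 2 * η) := by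
    intro z
    by_cases hzp : dist z p ≤ 2 * r - ε
    · have hsub : Metric.closedBall z ε ⊆ Metric.closedBall p (2 * r) :=
        Metric.closedBall_subset_closedBall' (by linarith)
      have hsubK : Metric.closedBall z ε ⊆ Kᶜ := fun w hw h => (hrp w (hsub hw)).1 (Or.inl h)
      have h1 : ∀ w ∈ Metric.closedBall z ε, F w = G w - t := fun w hw =>
        max_eq_left (by linarith [hG1 w (hsub hw)])
      have h2 : A F z = A G z - t := by
        have h3 : A F z = Real.circleAverage (fun w => G w - t) z ε := by
          refine Real.circleAverage_congr_sphere fun w hw => ?_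
          rw [abs_of_pos hε] at hw
          exact h1 w (Metric.sphere_subset_closedBall hw)
        rw [h3, Real.circleAverage_fun_sub (hGc.continuousOn.circleIntegrable hε.le)
          (circleIntegrable_const _ _ _), Real.circleAverage_const]
      have h4 : A G z = G z - truncLogDefect r ε p z := circleAverage_cutGreen hφh hr hε hsubK
      have : κ z = 0 := by
        simp only [hκ]
        rw [h2, h4, h1 z (Metric.mem_closedBall_self hε.le)]; ring
      exact ⟨this.ge, fun h => absurd this h⟩
    · have hd : r + ε ≤ ‖z - p‖ := by rw [← dist_eq_norm]; linarith
      have hκz : κ z = A F z - F z := by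
        simp only [hκ]
        rw [truncLogDefect_eq_zero hε hr hd, add_zero]
      by_cases hex : ∃ w ∈ Metric.closedBall z ε, F w ≠ 0
      · obtain ⟨w, hw, hwF⟩ := hex
        have hd2 : ∀ x ∈ Metric.closedBall z ε, dist w x ≤ 2 * ε := fun x hx => by
          rw [Metric.mem_closedBall] at hw hx
          linarith [dist_triangle_right w x z]
        have hsubK : Metric.closedBall z ε ⊆ Kᶜ := fun x hx => hδS
          (Metric.mem_thickening_iff.2 ⟨w, hFS w hwF, by
            rw [dist_comm]; exact lt_of_le_of_lt (hd2 x hx) hεδ⟩)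
        have hfarp : ∀ x ∈ Metric.closedBall z ε, r ≤ ‖x - p‖ := by
          intro x hx
          rw [Metric.mem_closedBall, dist_comm, dist_eq_norm] at hx
          have : ‖z - p‖ ≤ ‖z - x‖ + ‖x - p‖ := norm_sub_le_norm_sub_add_norm_sub _ _ _
          linarith
        have hGf : ∀ x ∈ Metric.closedBall z ε, G x = f x := fun x hx =>
          cutGreen_eq hφ hr (hsubK hx) (hfarp x hx)
        have hharm : InnerProductSpace.HarmonicOnNhd f (Metric.closedBall z ε) := by
          refine fun x hx => hf.harmonic x fun h => h.elim (hsubK hx) fun h => ?_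
          rw [mem_singleton_iff] at h
          have := hfarp x hx
          rw [h, sub_self, norm_zero] at this
          linarith
        have hAG : A G z = G z := by
          rw [hGf z (Metric.mem_closedBall_self hε.le)]
          exact circleAverage_eq_of_eqOn_closedBall hε hharm fun x hx =>
            hGf x (Metric.sphere_subset_closedBall hx)
        have hAGt : Real.circleAverage (fun w => G w - t) z ε = G z - t := by
          rw [Real.circleAverage_fun_sub (hGc.continuousOn.circleIntegrable hε.le)
            (circleIntegrable_const _ _ _), Real.circleAverage_const]
          exact congrArg (· - t) hAG
        have hci : CircleIntegrable F z ε := hFc.continuousOn.circleIntegrable hε.le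
        constructor
        · rw [hκz, sub_nonneg]
          refine max_le ?_ (Real.circleAverage_nonneg_of_nonneg fun x _ => le_max_right _ _)
          rw [← hAGt]
          exact Real.circleAverage_mono
            ((hGc.sub continuous_const).continuousOn.circleIntegrable hε.le) hci
            fun x _ => le_max_left _ _
        · intro hne
          obtain ⟨x, hx, hxt⟩ : ∃ x ∈ Metric.closedBall z ε, G x < t := by
            by_contra hall
            push Not at hall
            have h1 : ∀ x ∈ Metric.closedBall z ε, F x = G x - t := fun x hx =>
              max_eq_left (by linarith [hall x hx])
            refine hne ?_
            rw [hκz, h1 z (Metric.mem_closedBall_self hε.le), ← hAGt, sub_eq_zero]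
            refine Real.circleAverage_congr_sphere fun x hx => ?_
            rw [abs_of_pos hε] at hx
            exact h1 x (Metric.sphere_subset_closedBall hx)
          have hxF : F x = 0 := max_eq_right (by linarith)
          have h2 := hδF (lt_of_le_of_lt (hd2 x hx) hε1)
          rw [hxF, Real.dist_eq, sub_zero] at h2
          have h3 : 0 < F w := lt_of_le_of_ne (le_max_right _ _) hwF.symm
          rw [abs_of_pos h3] at h2
          have h4 : F w = G w - t := by
            refine max_eq_left (le_of_not_gt fun h => ?_)
            exact hwF (max_eq_right h.le)
          have h5 := hGH w (by linarith) (by linarith)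
          have h6 := hδH (a := z) (b := w) (by
            rw [dist_comm]; exact lt_of_le_of_lt hw hε2)
          rw [Real.dist_eq] at h6
          rw [sub_zero]
          calc |H z| = |(H z - H w) + H w| := by rw [sub_add_cancel]
            _ ≤ |H z - H w| + |H w| := abs_add_le _ _
            _ ≤ 2 * η := by linarith
      · push Not at hex
        have h1 : A F z = 0 := Real.circleAverage_const_on_circle fun x hx => by
          rw [abs_of_pos hε] at hx
          exact hex x (Metric.sphere_subset_closedBall hx)
        have : κ z = 0 := by
          rw [hκz, h1, hex z (Metric.mem_closedBall_self hε.le), sub_zero]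
        exact ⟨this.ge, fun h => absurd this h⟩
  set m := ∫ z, truncLogDefect r ε p z with hm
  have hm0 : 0 < m := integral_truncLogDefect_pos hε (by linarith) p
  have hmq : ∫ z, truncLogDefect r ε q z = m := integral_truncLogDefect_eq r ε q p
  have hiF : Integrable F := hFc.integrable_of_hasCompactSupport hFs
  have hiAF : Integrable (A F) := hAFc.integrable_of_hasCompactSupport hAFs
  have hiD : Integrable (truncLogDefect r ε p) := (hDc p).integrable_of_hasCompactSupport (hDs p)
  have hκm : ∫ z, κ z = m := by
    have h1 : ∫ z, κ z = (∫ z, (A F z - F z)) + m := integral_add (hiAF.sub hiF) hiD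
    have h2 : ∫ z, (A F z - F z) = (∫ z, A F z) - ∫ z, F z := integral_sub hiAF hiF
    rw [h1, h2, integral_circleAverage hFc hFs, sub_self, zero_add]
  -- the three terms of Green's identity
  have hd0 : ∀ c z, truncLogDefect r ε c z ≠ 0 → z ∈ Metric.closedBall c (2 * r) := by
    intro c z hz
    by_contra h
    rw [Metric.mem_closedBall, dist_eq_norm, not_le] at h
    exact hz (truncLogDefect_eq_zero hε hr (by linarith))
  have e1 := abs_integral_mul_sub_le hHc hκc hκs (fun z => (hκ0 z).1) (fun z => (hκ0 z).2)
  have e2 := abs_integral_mul_sub_le (c := h p) (η := η) hHc (hDc p) (hDs p)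
    (truncLogDefect_nonneg hε (by linarith) p) fun z hz => by
      have hz' := hd0 p z hz
      rw [hH, cutGreen_eq hψ hr (fun h => (hrp z hz').1 (Or.inl h)) (hfar z hz')]
      exact (hrp z hz').2.1
  have e3 := abs_integral_mul_sub_le (c := max (f q - t) 0) (η := η) hFc (hDc q) (hDs q)
    (truncLogDefect_nonneg hε (by linarith) q) fun z hz => by
      have hz' := hd0 q z hz
      simp only [hF]
      rw [hG, cutGreen_eq hφ hr (fun h => (hrq z hz').1 (Or.inl h)) (hfar' z hz')]
      refine (abs_max_sub_max_le_abs _ _ _).trans ?_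
      rw [sub_sub_sub_cancel_right]
      exact (hrq z hz').2
  -- Green's identity
  have hid : -∫ z, F z * truncLogDefect r ε q z =
      (∫ z, H z * κ z) - ∫ z, H z * truncLogDefect r ε p z := by
    have h1 := integral_mul_circleAverage_comm hFc hFs hHc ε
    have h2 : ∀ z, F z * Real.circleAverage H z ε =
        F z * H z - F z * truncLogDefect r ε q z := by
      intro z
      by_cases hz : F z = 0
      · simp [hz]
      · have hsubK : Metric.closedBall z ε ⊆ Kᶜ := fun x hx => hδS
          (Metric.mem_thickening_iff.2 ⟨z, hFS z hz, by
            rw [Metric.mem_closedBall] at hx; linarith⟩)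
        rw [circleAverage_cutGreen hψh hr hε hsubK, mul_sub]
    have h3 : ∀ z, H z * Real.circleAverage F z ε =
        F z * H z + (H z * κ z - H z * truncLogDefect r ε p z) := by
      intro z
      simp only [hκ, hA]; ring
    have hi1 : Integrable fun z => F z * H z :=
      (hFc.mul hHc).integrable_of_hasCompactSupport hFs.mul_right
    have hi2 : Integrable fun z => F z * truncLogDefect r ε q z :=
      (hFc.mul (hDc q)).integrable_of_hasCompactSupport hFs.mul_right
    have hi3 : Integrable fun z => H z * κ z :=
      (hHc.mul hκc).integrable_of_hasCompactSupport hκs.mul_left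
    have hi4 : Integrable fun z => H z * truncLogDefect r ε p z :=
      (hHc.mul (hDc p)).integrable_of_hasCompactSupport (hDs p).mul_left
    simp only [h2, h3] at h1
    have hi5 : Integrable fun z => H z * κ z - H z * truncLogDefect r ε p z := hi3.sub hi4
    rw [integral_sub hi1 hi2, integral_add hi1 hi5, integral_sub hi3 hi4] at h1
    linarith
  rw [hκm, zero_mul, sub_zero] at e1
  rw [hmq] at e3
  have hfq : 0 ≤ f q := hf.nonneg hK hp hq hpq.symm
  have h1 : |(max (f q - t) 0 - h p) * m| ≤ 4 * η * m := by
    rw [abs_le] at e1 e2 e3 ⊢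
    constructor <;> nlinarith
  rw [abs_mul, abs_of_pos hm0] at h1
  have h2 : |max (f q - t) 0 - h p| ≤ 4 * η := le_of_mul_le_mul_right h1 hm0
  have h3 : |f q - max (f q - t) 0| ≤ η := by
    rcases max_cases (f q - t) 0 with ⟨h, h'⟩ | ⟨h, h'⟩ <;> rw [h, abs_le] <;>
      constructor <;> linarith
  rw [abs_le] at h2 h3 ⊢
  constructor <;> linarith

/-! ### Inversion about a boundary point -/

/-- The set of all `ζ ≠ 0` with `e + 1 / ζ ∈ K`. For compact `K ∋ e`, the map `ζ ↦ e + 1 / ζ`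
identifies the plane without this closed set with `(ℂ ∪ {∞}) ∖ K`, and `0` corresponds to `∞`. -/
def invSet (K : Set ℂ) (e : ℂ) : Set ℂ := {ζ | ζ ≠ 0 ∧ e + ζ⁻¹ ∈ K}

/-- The function `u` in the coordinate `ζ` with `z = e + 1 / ζ`, with the value `L` at `ζ = 0`. -/
noncomputable def invFun (u : ℂ → ℝ) (e : ℂ) (L : ℝ) : ℂ → ℝ :=
  Function.update (fun ζ => u (e + ζ⁻¹)) 0 L

section Inversion

variable {K : Set ℂ} {e : ℂ} {u : ℂ → ℝ} {L : ℝ}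

lemma invFun_zero : invFun u e L 0 = L := Function.update_self _ _ _

lemma invFun_of_ne {ζ : ℂ} (hζ : ζ ≠ 0) : invFun u e L ζ = u (e + ζ⁻¹) :=
  Function.update_of_ne hζ _ _

lemma invFun_inv_sub {z : ℂ} (hz : z ≠ e) : invFun u e L (z - e)⁻¹ = u z := by
  rw [invFun_of_ne (inv_ne_zero (sub_ne_zero.2 hz)), inv_inv, add_sub_cancel]

lemma invFun_eventuallyEq {ζ : ℂ} (hζ : ζ ≠ 0) :
    invFun u e L =ᶠ[𝓝 ζ] fun ζ => u (e + ζ⁻¹) := by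
  filter_upwards [isOpen_ne.mem_nhds hζ] with w hw using invFun_of_ne hw

lemma inv_sub_notMem_invSet {z : ℂ} (hz : z ∉ K) : (z - e)⁻¹ ∉ invSet K e := by
  intro h
  rw [invSet, mem_ofPred_eq, inv_inv, add_sub_cancel] at h
  exact hz h.2

lemma zero_notMem_invSet : (0 : ℂ) ∉ invSet K e := fun h => h.1 rfl

lemma tendsto_add_inv_cocompact (e : ℂ) :
    Tendsto (fun ζ : ℂ => e + ζ⁻¹) (𝓝[≠] 0) (cocompact ℂ) := by
  rw [← Metric.cobounded_eq_cocompact]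
  exact (tendsto_const_add_cobounded e).comp tendsto_inv₀_nhdsNE_zero

lemma continuousAt_add_inv {e ζ : ℂ} (hζ : ζ ≠ 0) : ContinuousAt (fun ζ : ℂ => e + ζ⁻¹) ζ :=
  continuousAt_const.add (continuousAt_inv₀ hζ)

lemma isClosed_invSet (hK : IsCompact K) : IsClosed (invSet K e) := by
  rw [← isOpen_compl_iff, isOpen_iff_mem_nhds]
  intro ζ hζ
  by_cases h0 : ζ = 0
  · subst h0
    have := eventually_nhdsWithin_iff.1
      ((tendsto_add_inv_cocompact e).eventually hK.compl_mem_cocompact)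
    filter_upwards [this] with w hw h
    exact hw h.1 h.2
  · have h1 : e + ζ⁻¹ ∈ Kᶜ := fun h => hζ ⟨h0, h⟩
    filter_upwards [(continuousAt_add_inv h0).preimage_mem_nhds
      (hK.isClosed.isOpen_compl.mem_nhds h1)] with w hw h
    exact hw h.2

lemma tendsto_add_inv_nhdsWithin {ζ : ℂ} (hζ : ζ ∈ invSet K e) :
    Tendsto (fun ζ : ℂ => e + ζ⁻¹) (𝓝[(invSet K e)ᶜ] ζ) (𝓝[Kᶜ] (e + ζ⁻¹)) := by
  refine tendsto_nhdsWithin_iff.2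
    ⟨(continuousAt_add_inv hζ.1).tendsto.mono_left nhdsWithin_le_nhds, ?_⟩
  filter_upwards [self_mem_nhdsWithin, nhdsWithin_le_nhds (isOpen_ne.mem_nhds hζ.1)] with w hw h0 h
  exact hw ⟨h0, h⟩

lemma tendsto_add_inv_infty :
    Tendsto (fun ζ : ℂ => e + ζ⁻¹) (cocompact ℂ ⊓ 𝓟 (invSet K e)ᶜ) (𝓝[Kᶜ] e) := by
  refine tendsto_nhdsWithin_iff.2 ⟨?_, ?_⟩
  · have : Tendsto (fun ζ : ℂ => e + ζ⁻¹) (cocompact ℂ) (𝓝 (e + 0)) := by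
      rw [← Metric.cobounded_eq_cocompact]
      exact tendsto_const_nhds.add tendsto_inv₀_cobounded
    rw [add_zero] at this
    exact this.mono_left inf_le_left
  · have h0 : ∀ᶠ w : ℂ in cocompact ℂ, w ≠ 0 :=
      (isCompact_singleton (x := (0 : ℂ))).compl_mem_cocompact
    rw [eventually_inf_principal]
    filter_upwards [h0] with w hw hw2 h
    exact hw2 ⟨hw, h⟩

lemma invFun_infty_eventuallyEq (s : Set ℂ) :
    invFun u e L =ᶠ[cocompact ℂ ⊓ 𝓟 s] fun ζ => u (e + ζ⁻¹) := by
  have h0 : ∀ᶠ w : ℂ in cocompact ℂ, w ≠ 0 :=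
    (isCompact_singleton (x := (0 : ℂ))).compl_mem_cocompact
  exact (h0.filter_mono inf_le_left).mono fun w hw => invFun_of_ne hw

lemma harmonicAt_invFun {ζ : ℂ} (hζ : ζ ≠ 0) (hu : InnerProductSpace.HarmonicAt u (e + ζ⁻¹)) :
    InnerProductSpace.HarmonicAt (invFun u e L) ζ := by
  rw [InnerProductSpace.harmonicAt_congr_nhds (invFun_eventuallyEq hζ)]
  exact HarmonicAt.comp_analyticAt hu (analyticAt_const.add (analyticAt_inv hζ))

lemma harmonicAt_invFun_zero (hu : ∀ᶠ z in cocompact ℂ, InnerProductSpace.HarmonicAt u z)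
    (hL : Tendsto u (cocompact ℂ) (𝓝 L)) : InnerProductSpace.HarmonicAt (invFun u e L) 0 := by
  refine harmonicAt_update_of_tendsto ?_ (hL.comp (tendsto_add_inv_cocompact e))
  filter_upwards [(tendsto_add_inv_cocompact e).eventually hu, self_mem_nhdsWithin] with w hw h0
  exact HarmonicAt.comp_analyticAt hw (analyticAt_const.add (analyticAt_inv h0))

lemma boundary_invFun {ζ : ℂ} (hζ : ζ ∈ invSet K e) (hu : Tendsto u (𝓝[Kᶜ] (e + ζ⁻¹)) (𝓝 0)) :
    Tendsto (invFun u e L) (𝓝[(invSet K e)ᶜ] ζ) (𝓝 0) := by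
  refine (hu.comp (tendsto_add_inv_nhdsWithin hζ)).congr' ?_
  filter_upwards [nhdsWithin_le_nhds (invFun_eventuallyEq (u := u) (e := e) (L := L) hζ.1)]
    with w hw using hw.symm

lemma infty_invFun (hu : Tendsto u (𝓝[Kᶜ] e) (𝓝 0)) :
    Tendsto (invFun u e L) (cocompact ℂ ⊓ 𝓟 (invSet K e)ᶜ) (𝓝 0) :=
  (hu.comp tendsto_add_inv_infty).congr' (invFun_infty_eventuallyEq _).symm

/-- The maximum principle for harmonic functions on `(ℂ ∪ {∞}) ∖ K`. -/
theorem le_of_boundary_le (hK : IsCompact K) (hne : K.Nonempty)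
    (hu : InnerProductSpace.HarmonicOnNhd u Kᶜ) (hL : Tendsto u (cocompact ℂ) (𝓝 L)) {M : ℝ}
    (hb : ∀ x ∈ K, ∀ η > 0, ∀ᶠ z in 𝓝[Kᶜ] x, u z < M + η) :
    (∀ z, z ∉ K → u z ≤ M) ∧ L ≤ M := by
  obtain ⟨e, he⟩ := hne
  have hharm : InnerProductSpace.HarmonicOnNhd (invFun u e L) (invSet K e)ᶜ := by
    intro ζ hζ
    by_cases h0 : ζ = 0
    · subst h0
      refine harmonicAt_invFun_zero ?_ hL
      filter_upwards [hK.compl_mem_cocompact] with z hz using hu z hz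
    · exact harmonicAt_invFun h0 (hu _ fun h => hζ ⟨h0, h⟩)
  have key : ∀ η > 0, ∀ ζ, ζ ∉ invSet K e → invFun u e L ζ < M + η := by
    intro η hη ζ hζ
    by_contra hge
    have hcomp : IsCompact {ζ ∈ (invSet K e)ᶜ | M + η ≤ invFun u e L ζ} := by
      refine isCompact_superlevel
        (fun w hw => (hharm w hw).1.continuousAt.continuousWithinAt) ?_ ?_
      · intro x hx
        rw [notMem_compl_iff] at hx
        filter_upwards [(tendsto_add_inv_nhdsWithin hx).eventually (hb _ hx.2 η hη),
          nhdsWithin_le_nhds (invFun_eventuallyEq (u := u) (e := e) (L := L) hx.1)] with w hw hw2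
        rwa [hw2]
      · filter_upwards [tendsto_add_inv_infty.eventually (hb e he η hη),
          invFun_infty_eventuallyEq (u := u) (e := e) (L := L) (invSet K e)ᶜ] with w hw hw2
        rwa [hw2]
    have := superlevel_eq_empty_of_isCompact (isClosed_invSet hK).isOpen_compl hharm hcomp
    have hmem : ζ ∈ {ζ ∈ (invSet K e)ᶜ | M + η ≤ invFun u e L ζ} := ⟨hζ, not_lt.1 hge⟩
    rw [this] at hmem
    exact hmem
  refine ⟨fun z hz => le_of_forall_pos_le_add fun η hη => ?_,
    le_of_forall_pos_le_add fun η hη => ?_⟩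
  · have := key η hη (z - e)⁻¹ (inv_sub_notMem_invSet hz)
    rw [invFun_inv_sub (by rintro rfl; exact hz he)] at this
    exact this.le
  · have := key η hη 0 zero_notMem_invSet
    rw [invFun_zero] at this
    exact this.le

/-- The maximum principle for the modulus. -/
theorem abs_le_of_boundary_abs_le (hK : IsCompact K) (hne : K.Nonempty)
    (hu : InnerProductSpace.HarmonicOnNhd u Kᶜ) (hL : Tendsto u (cocompact ℂ) (𝓝 L)) {M : ℝ}
    (hb : ∀ x ∈ K, ∀ η > 0, ∀ᶠ z in 𝓝[Kᶜ] x, |u z| < M + η) :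
    (∀ z, z ∉ K → |u z| ≤ M) ∧ |L| ≤ M := by
  have h1 := le_of_boundary_le hK hne hu hL (M := M) fun x hx η hη =>
    (hb x hx η hη).mono fun z hz => (le_abs_self _).trans_lt hz
  have h2 := le_of_boundary_le hK hne hu.neg hL.neg (M := M) fun x hx η hη =>
    (hb x hx η hη).mono fun z hz => (neg_le_abs _).trans_lt hz
  refine ⟨fun z hz => abs_le.2 ⟨?_, h1.1 z hz⟩, abs_le.2 ⟨?_, h1.2⟩⟩
  · have := h2.1 z hz
    simp only [Pi.neg_apply] at this
    linarith
  · linarith [h2.2]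

lemma isPlaneGreen_invFun {c : ℂ} (hK : IsCompact K) (he : e ∈ K) (hc : c ∉ K)
    (hu : IsGreenAt K c u) (hL : Tendsto u (cocompact ℂ) (𝓝 L)) :
    IsPlaneGreen (invSet K e) (c - e)⁻¹ (invFun u e L) := by
  have hce : c - e ≠ 0 := sub_ne_zero.2 fun h => hc (h ▸ he)
  constructor
  · intro ζ hζ
    by_cases h0 : ζ = 0
    · subst h0
      refine harmonicAt_invFun_zero ?_ hL
      filter_upwards [(hK.union (isCompact_singleton (x := c))).compl_mem_cocompact]
        with z hz using hu.harmonic z hz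
    · refine harmonicAt_invFun h0 (hu.harmonic _ ?_)
      rintro (h | h)
      · exact hζ (Or.inl ⟨h0, h⟩)
      · refine hζ (Or.inr ?_)
        rw [mem_singleton_iff] at h ⊢
        rw [← h, add_sub_cancel_left, inv_inv]
  · obtain ⟨r, hr⟩ := hu.pole
    set p := (c - e)⁻¹ with hp
    have hp0 : p ≠ 0 := inv_ne_zero hce
    have hpc : e + p⁻¹ = c := by rw [hp, inv_inv, add_sub_cancel]
    have h1 : Tendsto (fun ζ : ℂ => e + ζ⁻¹) (𝓝[≠] p) (𝓝[≠] c) := by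
      refine tendsto_nhdsWithin_iff.2 ⟨?_, ?_⟩
      · have := (continuousAt_add_inv (e := e) hp0).tendsto
        rw [hpc] at this
        exact this.mono_left nhdsWithin_le_nhds
      · filter_upwards [self_mem_nhdsWithin] with ζ hζ h
        rw [mem_singleton_iff] at h
        refine hζ ?_
        rw [mem_singleton_iff, hp, ← h, add_sub_cancel_left, inv_inv]
    have h2 : Tendsto (fun ζ : ℂ => Real.log ‖ζ‖) (𝓝[≠] p) (𝓝 (Real.log ‖p‖)) := by
      have : ContinuousAt (fun ζ : ℂ => Real.log ‖ζ‖) p :=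
        continuousAt_id.norm.log (norm_ne_zero_iff.2 hp0)
      exact this.tendsto.mono_left nhdsWithin_le_nhds
    refine ⟨r + (Real.log ‖p‖ + Real.log ‖p‖),
      ((hr.comp h1).add (h2.add_const (Real.log ‖p‖))).congr' ?_⟩
    filter_upwards [self_mem_nhdsWithin, nhdsWithin_le_nhds (isOpen_ne.mem_nhds hp0)] with ζ hζ h0
    have h0' : ζ ≠ 0 := h0
    have h3 : e + ζ⁻¹ - c = (p - ζ) / (ζ * p) := by
      rw [← hpc]; field_simp; ring
    have h4 : ‖p - ζ‖ ≠ 0 := norm_ne_zero_iff.2 (sub_ne_zero.2 (Ne.symm hζ))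
    simp only [Function.comp]
    rw [invFun_of_ne h0', h3, norm_div, norm_mul, Real.log_div h4
      (mul_ne_zero (norm_ne_zero_iff.2 h0') (norm_ne_zero_iff.2 hp0)),
      Real.log_mul (norm_ne_zero_iff.2 h0') (norm_ne_zero_iff.2 hp0), norm_sub_rev p ζ]
    ring
  · exact fun ζ hζ => boundary_invFun hζ (hu.boundary _ hζ.2)
  · exact infty_invFun (hu.boundary e he)

lemma isPlaneGreen_invFun_infty (he : e ∈ K) (hu : IsGreenAtInfty K u) :
    IsPlaneGreen (invSet K e) 0 (invFun u e 0) := by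
  constructor
  · intro ζ hζ
    have h0 : ζ ≠ 0 := fun h => hζ (Or.inr h)
    exact harmonicAt_invFun h0 (hu.harmonic _ fun h => hζ (Or.inl ⟨h0, h⟩))
  · obtain ⟨r, hr⟩ := hu.pole
    have h1 : Tendsto (fun ζ : ℂ => Real.log ‖e * ζ + 1‖) (𝓝[≠] 0) (𝓝 (Real.log ‖e * 0 + 1‖)) := by
      have : ContinuousAt (fun ζ : ℂ => Real.log ‖e * ζ + 1‖) 0 := by
        refine ContinuousAt.log (by fun_prop) ?_
        simp
      exact this.tendsto.mono_left nhdsWithin_le_nhds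
    refine ⟨r + Real.log ‖e * 0 + 1‖,
      ((hr.comp (tendsto_add_inv_cocompact e)).add h1).congr' ?_⟩
    have h2 : ∀ᶠ ζ : ℂ in 𝓝[≠] 0, e + ζ⁻¹ ≠ 0 :=
      (tendsto_add_inv_cocompact e).eventually
        (isCompact_singleton (x := (0 : ℂ))).compl_mem_cocompact
    filter_upwards [self_mem_nhdsWithin, h2] with ζ hζ h3
    have hζ0 : ζ ≠ 0 := hζ
    have h4 : e * ζ + 1 = (e + ζ⁻¹) * ζ := by field_simp
    simp only [Function.comp]
    rw [invFun_of_ne hζ0, h4, norm_mul, Real.log_mul (norm_ne_zero_iff.2 h3)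
      (norm_ne_zero_iff.2 hζ0), sub_zero]
    ring
  · exact fun ζ hζ => boundary_invFun hζ (hu.boundary _ hζ.2)
  · exact infty_invFun (hu.boundary e he)

/-- Symmetry of the Green's function for a finite pole and `∞`. -/
theorem IsGreenAt.limit_eq {c : ℂ} {g : ℂ → ℝ} (hK : IsCompact K) (hne : K.Nonempty) (hc : c ∉ K)
    (hu : IsGreenAt K c u) (hL : Tendsto u (cocompact ℂ) (𝓝 L)) (hg : IsGreenAtInfty K g) :
    L = g c := by
  obtain ⟨e, he⟩ := hne
  have hce : c ≠ e := fun h => hc (h ▸ he)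
  have := (isPlaneGreen_invFun_infty he hg).symm (isClosed_invSet hK) zero_notMem_invSet
    (inv_sub_notMem_invSet hc) (inv_ne_zero (sub_ne_zero.2 hce)).symm
    (isPlaneGreen_invFun hK he hc hu hL)
  rw [invFun_inv_sub hce, invFun_zero] at this
  exact this.symm

/-- Symmetry of the Green's function for two finite poles. -/
theorem IsGreenAt.apply_eq {c d : ℂ} {v : ℂ → ℝ} (hK : IsCompact K) (hne : K.Nonempty)
    (hc : c ∉ K) (hd : d ∉ K) (hcd : c ≠ d) (hu : IsGreenAt K c u) (hv : IsGreenAt K d v) :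
    u d = v c := by
  obtain ⟨e, he⟩ := hne
  obtain ⟨L, hL⟩ := hu.infty
  obtain ⟨L', hL'⟩ := hv.infty
  have hce : c ≠ e := fun h => hc (h ▸ he)
  have hde : d ≠ e := fun h => hd (h ▸ he)
  have := (isPlaneGreen_invFun hK he hc hu hL).symm (isClosed_invSet hK)
    (inv_sub_notMem_invSet hc) (inv_sub_notMem_invSet hd)
    (fun h => hcd (sub_left_injective (inv_injective h))) (isPlaneGreen_invFun hK he hd hv hL')
  rwa [invFun_inv_sub hde, invFun_inv_sub hce] at this

/-- For a compact set `K ⊆ ℝ`, the Green's function with a finite real pole is positive at `∞`: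
otherwise it would vanish identically near `∞`, hence in the upper half-plane, hence near the
pole. -/
theorem IsGreenAt.limit_pos {c : ℝ} (hK : IsCompact K) (hne : K.Nonempty)
    (hKre : ∀ z ∈ K, z.im = 0) (hc : (c : ℂ) ∉ K) (hu : IsGreenAt K c u)
    (hL : Tendsto u (cocompact ℂ) (𝓝 L)) : 0 < L := by
  obtain ⟨e, he⟩ := hne
  have hce : (c : ℂ) ≠ e := fun h => hc (h ▸ he)
  have hpg := isPlaneGreen_invFun hK he hc hu hL
  have hp0 : (c - e : ℂ)⁻¹ ≠ 0 := inv_ne_zero (sub_ne_zero.2 hce)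
  have hnn := fun ζ (h1 : ζ ∉ invSet K e) h2 => hpg.nonneg (isClosed_invSet hK)
    (inv_sub_notMem_invSet hc) (z := ζ) h1 h2
  have hO := isOpen_compl_union_singleton (isClosed_invSet (e := e) hK) (c - e)⁻¹
  have h0O : (0 : ℂ) ∈ (invSet K e ∪ {(c - e : ℂ)⁻¹})ᶜ :=
    fun h => h.elim zero_notMem_invSet fun h => hp0 h.symm
  have hL0 : 0 ≤ L := by
    have := hnn 0 zero_notMem_invSet hp0.symm
    rwa [invFun_zero] at this
  refine lt_of_le_of_ne hL0 fun hL00 => ?_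
  have hmin : IsLocalMin (invFun u e L) 0 := by
    filter_upwards [hO.mem_nhds h0O] with w hw
    rw [invFun_zero, ← hL00]
    exact hL00 ▸ hnn w (fun h => hw (Or.inl h)) fun h => hw (Or.inr h)
  have hev := HarmonicAt.eventually_eq_of_isLocalMin (hpg.harmonic 0 h0O) hmin
  rw [invFun_zero, ← hL00] at hev
  have hinv : Tendsto (fun z : ℂ => (z - e)⁻¹) (cocompact ℂ) (𝓝 0) := by
    rw [← Metric.cobounded_eq_cocompact]
    exact tendsto_inv₀_cobounded.comp (tendsto_sub_const_cobounded e)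
  have hu0 : ∀ᶠ z in cocompact ℂ, u z = 0 := by
    filter_upwards [hinv.eventually hev, hK.compl_mem_cocompact] with z hz hzK
    rwa [invFun_inv_sub (by rintro rfl; exact hzK he)] at hz
  -- hence `u` vanishes in the upper half-plane
  rw [← Metric.cobounded_eq_cocompact, Metric.hasBasis_cobounded_compl_closedBall 0
    |>.eventually_iff] at hu0
  obtain ⟨R, -, hR⟩ := hu0
  set U : Set ℂ := {z | 0 < z.im} with hU
  have hUpre : IsPreconnected U := (convex_halfSpace_im_gt 0).isPreconnected
  have hUK : U ⊆ (K ∪ {(c : ℂ)})ᶜ := by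
    rintro z hz (h | h)
    · have := hKre z h
      exact absurd hz (by rw [hU, mem_ofPred_eq, this]; exact lt_irrefl _)
    · rw [mem_singleton_iff] at h
      exact absurd hz (by rw [hU, mem_ofPred_eq, h, Complex.ofReal_im]; exact lt_irrefl _)
  have han : AnalyticOnNhd ℝ u U := fun z hz => HarmonicAt.analyticAt (hu.harmonic z (hUK hz))
  set z₀ : ℂ := ((|R| + 1 : ℝ) : ℂ) * Complex.I with hz₀
  have hz₀n : ‖z₀‖ = |R| + 1 := by
    rw [hz₀, norm_mul, Complex.norm_real, Complex.norm_I, mul_one, Real.norm_eq_abs,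
      abs_of_pos (by positivity)]
  have hz₀U : z₀ ∈ U := by
    rw [hU, mem_ofPred_eq, hz₀, Complex.im_ofReal_mul,
      Complex.I_im, mul_one]
    positivity
  have hz₀0 : u =ᶠ[𝓝 z₀] 0 := by
    have : z₀ ∈ (Metric.closedBall (0 : ℂ) R)ᶜ := by
      rw [mem_compl_iff, Metric.mem_closedBall, dist_zero_right, hz₀n, not_le]
      linarith [le_abs_self R]
    filter_upwards [Metric.isClosed_closedBall.isOpen_compl.mem_nhds this] with z hz using hR hz
  have hU0 := han.eqOn_zero_of_preconnected_of_eventuallyEq_zero hUpre hz₀U hz₀0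
  -- this contradicts the pole at `c`
  have h1 : ∀ᶠ z in 𝓝[≠] (c : ℂ), 0 < u z :=
    (tendsto_atTop_of_pole hu.pole).eventually_gt_atTop 0
  have h2 : Tendsto (fun y : ℝ => (c : ℂ) + y * Complex.I) (𝓝[>] 0) (𝓝[≠] (c : ℂ)) := by
    refine tendsto_nhdsWithin_iff.2 ⟨?_, ?_⟩
    · have : Tendsto (fun y : ℝ => (c : ℂ) + y * Complex.I) (𝓝 0)
          (𝓝 ((c : ℂ) + (0 : ℝ) * Complex.I)) := Continuous.tendsto (by fun_prop) 0
      rw [Complex.ofReal_zero, zero_mul, add_zero] at this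
      exact this.mono_left nhdsWithin_le_nhds
    · filter_upwards [self_mem_nhdsWithin] with y hy h
      rw [mem_singleton_iff, add_eq_left] at h
      rcases mul_eq_zero.1 h with h | h
      · exact (mem_Ioi.1 hy).ne' (Complex.ofReal_eq_zero.1 h)
      · exact Complex.I_ne_zero h
  obtain ⟨y, hy, hy0⟩ := ((h2.eventually h1).and self_mem_nhdsWithin).exists
  have : (c : ℂ) + y * Complex.I ∈ U := by
    rw [hU, mem_ofPred_eq]; simpa using hy0
  rw [hU0 this] at hy
  exact lt_irrefl _ hy

end Inversion

/-! ### The equilibrium potential of an interval -/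

/-- The modulus of `(√(z - B) + √(z - C)) ^ 2 / 4`, written without square roots of complex numbers.
Its logarithm is the logarithmic potential of the equilibrium measure of `[B, C]`. -/
noncomputable def joukowskiNorm (B C : ℝ) (z : ℂ) : ℝ :=
  (‖z - B‖ + ‖z - C‖ +
    √(2 * (‖z - B‖ * ‖z - C‖ + ((z - C) * starRingEnd ℂ (z - B)).re))) / 4

section Joukowski

variable {B C : ℝ}

lemma continuous_joukowskiNorm : Continuous (joukowskiNorm B C) := by
  unfold joukowskiNorm
  refine Continuous.div_const (Continuous.add (by fun_prop) (Continuous.sqrt ?_)) 4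
  refine continuous_const.mul (Continuous.add (by fun_prop) (Complex.continuous_re.comp ?_))
  exact (continuous_id.sub continuous_const).mul
    (Complex.continuous_conj.comp (continuous_id.sub continuous_const))

lemma joukowskiNorm_of_mem {x : ℝ} (hx : x ∈ Icc B C) :
    joukowskiNorm B C x = (C - B) / 4 := by
  have h1 : ‖(x : ℂ) - B‖ = x - B := by
    rw [← Complex.ofReal_sub, Complex.norm_real, Real.norm_eq_abs, abs_of_nonneg (by linarith [hx.1])]
  have h2 : ‖(x : ℂ) - C‖ = C - x := by
    rw [← Complex.ofReal_sub, Complex.norm_real, Real.norm_eq_abs, abs_of_nonpos (by linarith [hx.2])]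
    ring
  have h3 : (((x : ℂ) - C) * starRingEnd ℂ ((x : ℂ) - B)).re = (x - C) * (x - B) := by
    rw [← Complex.ofReal_sub, ← Complex.ofReal_sub, Complex.conj_ofReal, ← Complex.ofReal_mul,
      Complex.ofReal_re]
  have h4 : 2 * ((x - B) * (C - x) + (x - C) * (x - B)) = 0 := by ring
  rw [joukowskiNorm, h1, h2, h3, h4, Real.sqrt_zero]
  ring

lemma joukowskiNorm_eq {z : ℂ} (hz : z ≠ B) {σ : ℂ} (hσ : σ ^ 2 = (z - C) / (z - B))
    (hre : 0 ≤ σ.re) : joukowskiNorm B C z = ‖(z - B) * (1 + σ) ^ 2 / 4‖ := by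
  have hz0 : z - B ≠ 0 := sub_ne_zero.2 hz
  have hC : z - C = σ ^ 2 * (z - B) := by rw [hσ, div_mul_cancel₀ _ hz0]
  have h1 : ‖z - C‖ = ‖σ‖ ^ 2 * ‖z - B‖ := by rw [hC, norm_mul, norm_pow]
  have h2 : (z - C) * starRingEnd ℂ (z - B) = σ ^ 2 * ((‖z - B‖ ^ 2 : ℝ) : ℂ) := by
    rw [hC, mul_assoc, Complex.mul_conj, Complex.normSq_eq_norm_sq]
  have h3 : ((z - C) * starRingEnd ℂ (z - B)).re = (σ.re ^ 2 - σ.im ^ 2) * ‖z - B‖ ^ 2 := by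
    rw [h2, Complex.re_mul_ofReal, pow_two σ, Complex.mul_re]; ring
  have h4 : ‖σ‖ ^ 2 = σ.re ^ 2 + σ.im ^ 2 := by
    rw [← Complex.normSq_eq_norm_sq, Complex.normSq_apply]; ring
  have h5 : 2 * (‖z - B‖ * ‖z - C‖ + ((z - C) * starRingEnd ℂ (z - B)).re) =
      (2 * σ.re * ‖z - B‖) ^ 2 := by
    rw [h1, h3, h4]; ring
  have h6 : ‖1 + σ‖ ^ 2 = 1 + ‖σ‖ ^ 2 + 2 * σ.re := by
    rw [h4, ← Complex.normSq_eq_norm_sq, Complex.normSq_apply]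
    simp only [Complex.add_re, Complex.add_im, Complex.one_re, Complex.one_im]; ring
  rw [joukowskiNorm, h5, Real.sqrt_sq (by positivity), h1, norm_div, norm_mul, norm_pow, h6]
  have : ‖(4 : ℂ)‖ = 4 := by norm_num
  rw [this]; ring

lemma joukowskiNorm_mem_Icc (hBC : B ≤ C) {c : ℝ} (hc : c ∈ Icc B C) {z : ℂ}
    (hz : 2 * (C - B) ≤ ‖z - c‖) :
    joukowskiNorm B C z ∈ Icc (‖z - c‖ - (C - B)) (‖z - c‖ + (C - B)) := by
  set d := C - B with hd
  set R := ‖z - c‖ with hR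
  have hd0 : 0 ≤ d := by rw [hd]; linarith
  have hcB : ‖(c : ℂ) - B‖ = c - B := by
    rw [← Complex.ofReal_sub, Complex.norm_real, Real.norm_eq_abs, abs_of_nonneg (by linarith [hc.1])]
  have hcC : ‖(c : ℂ) - C‖ = C - c := by
    rw [← Complex.ofReal_sub, Complex.norm_real, Real.norm_eq_abs, abs_of_nonpos (by linarith [hc.2])]
    ring
  have hb1 : ‖z - B‖ ≤ R + (c - B) := by
    rw [← hcB]; exact norm_sub_le_norm_sub_add_norm_sub _ _ _
  have hb2 : R - (c - B) ≤ ‖z - B‖ := by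
    have := norm_sub_le_norm_sub_add_norm_sub z (B : ℂ) (c : ℂ)
    rw [norm_sub_rev (B : ℂ), hcB] at this; linarith
  have hc1 : ‖z - C‖ ≤ R + (C - c) := by
    rw [← hcC]; exact norm_sub_le_norm_sub_add_norm_sub _ _ _
  have hc2 : R - (C - c) ≤ ‖z - C‖ := by
    have := norm_sub_le_norm_sub_add_norm_sub z (C : ℂ) (c : ℂ)
    rw [norm_sub_rev (C : ℂ), hcC] at this; linarith
  have hmid : ‖(z - B) + (z - C)‖ ^ 2 =
      ‖z - B‖ ^ 2 + ‖z - C‖ ^ 2 + 2 * ((z - C) * starRingEnd ℂ (z - B)).re := by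
    rw [add_comm (z - B)]
    simp only [← Complex.normSq_eq_norm_sq]
    rw [Complex.normSq_add]; ring
  have hS : 2 * (‖z - B‖ * ‖z - C‖ + ((z - C) * starRingEnd ℂ (z - B)).re) =
      ‖(z - B) + (z - C)‖ ^ 2 - (‖z - B‖ - ‖z - C‖) ^ 2 := by rw [hmid]; ring
  have he : (z - B) + (z - C) = 2 * (z - c) + ((2 * c - B - C : ℝ) : ℂ) := by push_cast; ring
  have h2R : ‖2 * (z - c)‖ = 2 * R := by rw [norm_mul, Complex.norm_ofNat]
  have habs : ‖((2 * c - B - C : ℝ) : ℂ)‖ ≤ d := by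
    rw [Complex.norm_real, Real.norm_eq_abs, abs_le]
    constructor <;> linarith [hc.1, hc.2]
  have hm1 : ‖(z - B) + (z - C)‖ ≤ 2 * R + d := by
    rw [he]; exact (norm_add_le _ _).trans (by linarith)
  have hm2 : 2 * R - d ≤ ‖(z - B) + (z - C)‖ := by
    rw [he]
    have := norm_sub_le (2 * (z - c) + ((2 * c - B - C : ℝ) : ℂ)) ((2 * c - B - C : ℝ) : ℂ)
    rw [add_sub_cancel_right] at this
    linarith
  have hsq : (‖z - B‖ - ‖z - C‖) ^ 2 ≤ d ^ 2 := by
    refine sq_le_sq' ?_ ?_ <;> linarith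
  have hup : √(2 * (‖z - B‖ * ‖z - C‖ + ((z - C) * starRingEnd ℂ (z - B)).re)) ≤ 2 * R + d := by
    rw [hS]
    refine Real.sqrt_le_iff.2 ⟨by linarith, ?_⟩
    nlinarith [norm_nonneg ((z - B) + (z - C)), sq_nonneg (‖z - B‖ - ‖z - C‖)]
  have hlow : 2 * R - 2 * d ≤ √(2 * (‖z - B‖ * ‖z - C‖ + ((z - C) * starRingEnd ℂ (z - B)).re)) := by
    rw [hS]
    refine Real.le_sqrt_of_sq_le ?_
    have : (2 * R - d) ^ 2 ≤ ‖(z - B) + (z - C)‖ ^ 2 :=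
      pow_le_pow_left₀ (by linarith) hm2 2
    nlinarith
  rw [joukowskiNorm]
  constructor <;> linarith

/-- The equilibrium potential of an interval `[B, C]`: it is constant on the interval, and differs
little from `log |z - c|` with `c ∈ [B, C]` at points far from the interval. -/
lemma exists_interval_potential (hBC : B < C) :
    ∃ j : ℂ → ℝ, InnerProductSpace.HarmonicOnNhd j ((fun x : ℝ => (x : ℂ)) '' Icc B C)ᶜ ∧
      (∀ x ∈ Icc B C, Tendsto j (𝓝 (x : ℂ)) (𝓝 (Real.log ((C - B) / 4)))) ∧
      ∀ c ∈ Icc B C, ∀ z : ℂ, 2 * (C - B) ≤ ‖z - c‖ →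
        |j z - Real.log ‖z - c‖| ≤ 2 * (C - B) / ‖z - c‖ := by
  refine ⟨fun z => Real.log (joukowskiNorm B C z), fun z hz => ?_, fun x hx => ?_,
    fun c hc z hz => ?_⟩
  · have hslit : ∀ w ∈ ((fun x : ℝ => (x : ℂ)) '' Icc B C)ᶜ,
        w ≠ B ∧ (w - C) / (w - B) ∈ Complex.slitPlane := by
      intro w hw
      have hwB : w ≠ B := fun h => hw ⟨B, left_mem_Icc.2 hBC.le, h.symm⟩
      refine ⟨hwB, ?_⟩
      by_contra hns
      rw [Complex.mem_slitPlane_iff, not_or, not_lt, not_not] at hns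
      -- otherwise the quotient is `-s` with `s ≥ 0`, and `w = (C + s B) / (1 + s)`
      set s := -((w - C) / (w - B)).re with hs
      have hs0 : 0 ≤ s := by linarith [hns.1]
      have h1 : (w - C) / (w - B) = ((-s : ℝ) : ℂ) :=
        Complex.ext (by simp [hs]) (by simpa using hns.2)
      rw [div_eq_iff (sub_ne_zero.2 hwB)] at h1
      have h2 : (1 + s : ℂ) ≠ 0 := by
        have : (1 + s : ℝ) ≠ 0 := by positivity
        exact_mod_cast this
      have h3 : w = (((C + s * B) / (1 + s) : ℝ) : ℂ) := by
        push_cast at h1 ⊢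
        rw [eq_div_iff h2]
        linear_combination h1
      refine hw ⟨_, ⟨?_, ?_⟩, h3.symm⟩
      · rw [le_div_iff₀ (by positivity)]; nlinarith
      · rw [div_le_iff₀ (by positivity)]; nlinarith
    have hopen : IsOpen ((fun x : ℝ => (x : ℂ)) '' Icc B C)ᶜ :=
      (isCompact_Icc.image Complex.continuous_ofReal).isClosed.isOpen_compl
    set σ : ℂ → ℂ := fun w => Complex.exp (Complex.log ((w - C) / (w - B)) / 2) with hσ
    have hre : ∀ w, 0 ≤ (σ w).re := by
      intro w
      rw [hσ, Complex.exp_re]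
      refine mul_nonneg (Real.exp_pos _).le (Real.cos_nonneg_of_neg_pi_div_two_le_of_le ?_ ?_)
      · have := (Complex.neg_pi_lt_log_im ((w - C) / (w - B))).le
        rw [show (Complex.log ((w - C) / (w - B)) / 2).im =
          (Complex.log ((w - C) / (w - B))).im / 2 by simp]
        linarith
      · have := Complex.log_im_le_pi ((w - C) / (w - B))
        rw [show (Complex.log ((w - C) / (w - B)) / 2).im =
          (Complex.log ((w - C) / (w - B))).im / 2 by simp]
        linarith
    have heq : (fun z => Real.log (joukowskiNorm B C z)) =ᶠ[𝓝 z]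
        fun w => Real.log ‖(w - B) * (1 + σ w) ^ 2 / 4‖ := by
      filter_upwards [hopen.mem_nhds hz] with w hw
      rw [joukowskiNorm_eq (hslit w hw).1 ?_ (hre w)]
      rw [hσ, ← Complex.exp_nat_mul]
      have : ((2 : ℕ) : ℂ) * (Complex.log ((w - C) / (w - B)) / 2) =
          Complex.log ((w - C) / (w - B)) := by push_cast; ring
      rw [this, Complex.exp_log (Complex.slitPlane_ne_zero (hslit w hw).2)]
    rw [InnerProductSpace.harmonicAt_congr_nhds heq]
    have hzB : z - B ≠ 0 := sub_ne_zero.2 (hslit z hz).1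
    refine AnalyticAt.harmonicAt_log_norm (f := fun w => (w - B) * (1 + σ w) ^ 2 / 4) ?_ ?_
    · have h1 : AnalyticAt ℂ (fun w : ℂ => (w - C) / (w - B)) z :=
        (analyticAt_id.sub analyticAt_const).div (analyticAt_id.sub analyticAt_const) hzB
      have h2 : AnalyticAt ℂ σ z := ((h1.clog (hslit z hz).2).div_const).cexp
      exact (((analyticAt_id.sub analyticAt_const).mul
        ((analyticAt_const.add h2).pow 2)).div_const)
    · have h1 : 1 + σ z ≠ 0 := by
        intro h
        have := congrArg Complex.re h
        rw [Complex.add_re, Complex.one_re, Complex.zero_re] at this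
        linarith [hre z]
      exact div_ne_zero (mul_ne_zero hzB (pow_ne_zero 2 h1)) (by norm_num)
  · have h1 : joukowskiNorm B C x = (C - B) / 4 := joukowskiNorm_of_mem hx
    have h2 : ContinuousAt (fun z => Real.log (joukowskiNorm B C z)) (x : ℂ) := by
      refine continuous_joukowskiNorm.continuousAt.log ?_
      rw [h1]
      have : 0 < C - B := by linarith
      positivity
    rw [← h1]
    exact h2.tendsto
  · obtain ⟨h1, h2⟩ := joukowskiNorm_mem_Icc hBC.le hc hz
    set N := joukowskiNorm B C z
    set R := ‖z - c‖
    set d := C - B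
    have hd : 0 < d := sub_pos.2 hBC
    have hR : 0 < R := by linarith
    have hN : 0 < N := by linarith
    rw [← Real.log_div hN.ne' hR.ne', abs_le]
    constructor
    · -- `log x ≥ 1 - 1 / x`
      have h3 := Real.one_sub_inv_le_log_of_pos (div_pos hN hR)
      refine le_trans ?_ h3
      rw [inv_div, neg_le_sub_iff_le_add, div_le_iff₀ hN, add_mul, one_mul]
      have h4 : d ≤ 2 * d / R * N := by
        rw [div_mul_eq_mul_div, le_div_iff₀ hR]; nlinarith
      linarith
    · have h3 := Real.log_le_sub_one_of_pos (div_pos hN hR)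
      refine h3.trans ?_
      rw [sub_le_iff_le_add, div_le_iff₀ hR, add_mul, div_mul_cancel₀ _ hR.ne']
      linarith

end Joukowski

/-! ### The length of a short interval and its harmonic measure -/

lemma isCompact_ofReal_image (B C : ℝ) : IsCompact ((fun x : ℝ => (x : ℂ)) '' Icc B C) :=
  isCompact_Icc.image Complex.continuous_ofReal

lemma tendsto_log_sub_interval_potential {B C c : ℝ} {j : ℂ → ℝ}
    (hj : ∀ z : ℂ, 2 * (C - B) ≤ ‖z - c‖ →
      |j z - Real.log ‖z - c‖| ≤ 2 * (C - B) / ‖z - c‖) :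
    Tendsto (fun z : ℂ => Real.log ‖z - c‖ - j z) (cocompact ℂ) (𝓝 0) := by
  have h1 : Tendsto (fun z : ℂ => ‖z - c‖) (cocompact ℂ) atTop := by
    rw [← Metric.cobounded_eq_cocompact]
    exact tendsto_norm_cobounded_atTop.comp (tendsto_sub_const_cobounded (c : ℂ))
  refine squeeze_zero_norm' ?_ (h1.const_div_atTop (2 * (C - B)))
  filter_upwards [h1.eventually_ge_atTop (2 * (C - B))] with z hz
  rw [Real.norm_eq_abs, abs_sub_comm]
  exact hj z hz

lemma exists_pos_le_norm_sub {E : Set ℂ} (hE : IsClosed E) {p : ℂ} (hp : p ∉ E) :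
    ∃ δ > 0, ∀ z ∈ E, δ ≤ ‖z - p‖ := by
  obtain ⟨δ, hδ, h⟩ := Metric.isOpen_iff.1 hE.isOpen_compl p hp
  refine ⟨δ, hδ, fun z hz => not_lt.1 fun hlt => ?_⟩
  rw [← dist_eq_norm] at hlt
  exact h hlt hz

/-- If the intervals `I` outside `E` have a small total harmonic measure `W`, then a subinterval `T`
of `I` is short, since `W` is at least of the order of `1 / log (1 / |T|)`. -/
lemma exists_length_le_mul_sq {E : Set ℂ} (hE : IsCompact E) (hne : E.Nonempty)
    (hEre : ∀ z ∈ E, z.im = 0) {c : ℝ} (hc : (c : ℂ) ∉ E) {gc : ℂ → ℝ} (hgc : IsGreenAt E c gc) :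
    ∃ A > 0, ∃ η > 0, ∀ (I : Set ℂ) (U : ℂ → ℝ) (W B C : ℝ), IsCompact I →
      InnerProductSpace.HarmonicOnNhd U (E ∪ I)ᶜ →
      (∀ x ∈ E, Tendsto U (𝓝[(E ∪ I)ᶜ] x) (𝓝 0)) →
      (∀ x ∈ I, Tendsto U (𝓝[(E ∪ I)ᶜ] x) (𝓝 1)) → Tendsto U (cocompact ℂ) (𝓝 W) →
      B < C → c ∈ Icc B C → (fun x : ℝ => (x : ℂ)) '' Icc B C ⊆ I → C - B ≤ η →
      C - B ≤ A * W ^ 2 := by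
  obtain ⟨L, hL⟩ := hgc.infty
  have hL0 : 0 < L := hgc.limit_pos hE hne hEre hc hL
  obtain ⟨φ, hφh, hφ⟩ := exists_harmonic_eq_sub_log hE.isClosed hc hgc.harmonic hgc.pole
  obtain ⟨δ, hδ, hδE⟩ := exists_pos_le_norm_sub hE.isClosed hc
  obtain ⟨s, hs, hsφ⟩ : ∃ s > 0, ∀ z : ℂ, dist z c < s → φ z < φ c + 1 :=
    Metric.eventually_nhds_iff.1 ((hφh c hc).1.continuousAt.eventually_lt_const (by linarith))
  set θ := L / 2 with hθ
  have hθ0 : 0 < θ := by positivity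
  set R := max (φ c + 1) θ with hR
  refine ⟨8 * Real.exp R / θ ^ 2, by positivity, min (min 1 (s / 2)) (min (δ / 4) (δ * θ / 8)),
    by positivity, ?_⟩
  intro I U W B C hI hUh hUE hUI hUW hBC hcBC hTI hlen
  have hl0 : 0 < C - B := sub_pos.2 hBC
  have hl1 : C - B ≤ 1 := hlen.trans ((min_le_left _ _).trans (min_le_left _ _))
  have hls : C - B ≤ s / 2 := hlen.trans ((min_le_left _ _).trans (min_le_right _ _))
  have hlδ : C - B ≤ δ / 4 := hlen.trans ((min_le_right _ _).trans (min_le_left _ _))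
  have hlθ : C - B ≤ δ * θ / 8 := hlen.trans ((min_le_right _ _).trans (min_le_right _ _))
  obtain ⟨j, hjh, hjT, hj⟩ := exists_interval_potential hBC
  have hj := hj c hcBC
  set T : Set ℂ := (fun x : ℝ => (x : ℂ)) '' Icc B C with hT
  have hTc : IsCompact T := isCompact_ofReal_image B C
  set P : ℂ → ℝ := φ - j with hP
  set Q : ℝ := R + Real.log (4 / (C - B)) with hQ
  have hlog : 0 ≤ Real.log (4 / (C - B)) := Real.log_nonneg (by
    rw [le_div_iff₀ hl0]; linarith)
  have hQθ : θ ≤ Q := (le_max_right _ _).trans (by linarith)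
  have hPh : InnerProductSpace.HarmonicOnNhd P (E ∪ T)ᶜ := fun z hz =>
    (hφh z fun h => hz (Or.inl h)).sub (hjh z fun h => hz (Or.inr h))
  have hPlim : Tendsto P (cocompact ℂ) (𝓝 L) := by
    have := hL.add (tendsto_log_sub_interval_potential hj)
    rw [add_zero] at this
    refine this.congr' ?_
    filter_upwards [(isCompact_singleton (x := (c : ℂ))).compl_mem_cocompact] with z hz
    rw [hφ z hz, hP, Pi.sub_apply]; ring
  -- `P ≤ θ` approximately at `E`
  have hPE : ∀ x ∈ E, ∀ η > 0, ∀ᶠ z in 𝓝[(E ∪ T)ᶜ] x, P z < θ + η := by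
    intro x hx η hη
    have h1 : ∀ᶠ z in 𝓝[(E ∪ T)ᶜ] x, gc z < η :=
      ((hgc.boundary x hx).mono_left (nhdsWithin_mono x
        (compl_subset_compl.2 subset_union_left))).eventually_lt_const hη
    have h2 : ∀ᶠ z : ℂ in 𝓝 x, δ / 2 < ‖z - c‖ := by
      have : ContinuousAt (fun z : ℂ => ‖z - c‖) x := by fun_prop
      exact this.eventually_const_lt (by linarith [hδE x hx])
    filter_upwards [h1, nhdsWithin_le_nhds h2] with z h1 h2
    have hz : z ≠ c := by
      rintro rfl
      rw [sub_self, norm_zero] at h2; linarith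
    have h3 := (abs_le.1 (hj z (by linarith))).1
    have h4 : 2 * (C - B) / ‖z - c‖ ≤ θ := by
      rw [div_le_iff₀ (by linarith)]; nlinarith
    have h5 := hφ z hz
    rw [hP, Pi.sub_apply]; linarith
  -- hence `P ≤ Q` everywhere
  have hPQ : ∀ z, z ∉ E ∪ T → P z ≤ Q := by
    refine (le_of_boundary_le (hE.union hTc) (hne.mono subset_union_left) hPh hPlim ?_).1
    rintro x (hx | ⟨y, hy, rfl⟩) η hη
    · filter_upwards [hPE x hx η hη] with z hz
      linarith
    · have h1 : ∀ᶠ z in 𝓝 (y : ℂ), φ z < φ c + 1 := by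
        have hd : dist (y : ℂ) c < s := by
          rw [dist_eq_norm, ← Complex.ofReal_sub, Complex.norm_real, Real.norm_eq_abs, abs_lt]
          constructor <;> linarith [hy.1, hy.2, hcBC.1, hcBC.2]
        filter_upwards [Metric.isOpen_ball.mem_nhds hd] with z hz using hsφ z hz
      have h2 := (hjT y hy).eventually_const_lt
        (show Real.log ((C - B) / 4) - η < Real.log ((C - B) / 4) by linarith)
      filter_upwards [nhdsWithin_le_nhds h1, nhdsWithin_le_nhds h2] with z h1 h2
      have h3 : Real.log (4 / (C - B)) = -Real.log ((C - B) / 4) := by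
        rw [← Real.log_inv, inv_div]
      have h4 : φ c + 1 ≤ R := le_max_left _ _
      rw [hP, Pi.sub_apply, hQ, h3]; linarith
  -- comparison of `P - θ` with `Q * U`
  have hsub : (E ∪ I)ᶜ ⊆ (E ∪ T)ᶜ := compl_subset_compl.2 (union_subset_union_right E hTI)
  have hcmp := (le_of_boundary_le (u := P - Q • U) (L := L - Q * W) (M := θ) (hE.union hI)
    (hne.mono subset_union_left) ((hPh.mono hsub).sub (hUh.const_smul))
    (hPlim.sub (hUW.const_mul Q)) ?_).2
  · have h1 : θ ≤ Q * W := by linarith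
    have hQ0 : 0 < Q := hθ0.trans_le hQθ
    have hW : 0 < W := pos_of_mul_pos_right (hθ0.trans_le h1) hQ0.le
    have h2 : θ / W ≤ Q := (div_le_iff₀ hW).2 h1
    have h3 : Real.exp (θ / W) ≤ Real.exp R * (4 / (C - B)) := by
      rw [← Real.exp_log (show 0 < 4 / (C - B) by positivity), ← Real.exp_add]
      exact Real.exp_le_exp.2 h2
    have h4 : (θ / W) ^ 2 / 2 ≤ Real.exp (θ / W) := by
      have := Real.quadratic_le_exp_of_nonneg (show 0 ≤ θ / W by positivity)
      have : 0 ≤ θ / W := by positivity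
      linarith
    have h5 : (θ / W) ^ 2 / 2 ≤ Real.exp R * (4 / (C - B)) := h4.trans h3
    rw [div_pow, mul_div_assoc', div_div, div_le_div_iff₀ (by positivity) hl0] at h5
    rw [div_mul_eq_mul_div, le_div_iff₀ (by positivity)]
    linarith
  · rintro x (hx | hx) η hη
    · have h1 : ∀ᶠ z in 𝓝[(E ∪ I)ᶜ] x, -(η / 2) < Q * U z := by
        have := (hUE x hx).const_mul Q
        rw [mul_zero] at this
        exact this.eventually_const_lt (by linarith)
      have h2 := (hPE x hx (η / 2) (by linarith)).filter_mono (nhdsWithin_mono x hsub)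
      filter_upwards [h1, h2] with z h1 h2
      simp only [Pi.sub_apply, Pi.smul_apply, smul_eq_mul]
      linarith
    · have h1 : ∀ᶠ z in 𝓝[(E ∪ I)ᶜ] x, Q - θ < Q * U z := by
        have := (hUI x hx).const_mul Q
        rw [mul_one] at this
        exact this.eventually_const_lt (by linarith)
      filter_upwards [h1, self_mem_nhdsWithin] with z h1 h2
      have := hPQ z (hsub h2)
      simp only [Pi.sub_apply, Pi.smul_apply, smul_eq_mul]
      linarith

/-! ### The expansion of the Green's function -/

lemma HarmonicAt.exists_lipschitz {f : ℂ → ℝ} {p : ℂ} (hf : InnerProductSpace.HarmonicAt f p) :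
    ∃ A ≥ 0, ∃ s > 0, ∀ z, ‖z - p‖ ≤ s → |f z - f p| ≤ A * ‖z - p‖ := by
  obtain ⟨A, t, ht, hA⟩ := (hf.1.of_le one_le_two).exists_lipschitzOnWith
  obtain ⟨s, hs, hst⟩ := Metric.nhds_basis_closedBall.mem_iff.1 ht
  refine ⟨A, A.2, s, hs, fun z hz => ?_⟩
  have := hA.dist_le_mul z (hst (by rwa [Metric.mem_closedBall, dist_eq_norm])) p
    (hst (Metric.mem_closedBall_self hs.le))
  rwa [Real.dist_eq, dist_eq_norm] at this

lemma exists_uniform_of_finite {ι : Type*} [Finite ι] {P : ι → ℝ → ℝ → Prop}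
    (hmono : ∀ i A A' s s', A ≤ A' → 0 < s' → s' ≤ s → P i A s → P i A' s')
    (h : ∀ i, ∃ A, ∃ s > 0, P i A s) : ∃ A ≥ 0, ∃ s > 0, ∀ i, P i A s := by
  have := Fintype.ofFinite ι
  choose A s hs hP using h
  obtain ⟨A', hA'⟩ := (finite_range A).bddAbove
  obtain ⟨s', hs', hss⟩ : ∃ s' > 0, ∀ i, s' ≤ s i := by
    have h1 : ∀ᶠ x : ℝ in 𝓝[>] 0, ∀ i, x ≤ s i := eventually_all.2 fun i =>
      nhdsWithin_le_nhds (eventually_le_nhds (hs i))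
    obtain ⟨x, hx, hx0⟩ := (h1.and self_mem_nhdsWithin).exists
    exact ⟨x, hx0, hx⟩
  exact ⟨max A' 0, le_max_right _ _, s', hs', fun i =>
    hmono i _ _ _ _ ((hA' (mem_range_self i)).trans (le_max_left _ _)) hs' (hss i) (hP i)⟩

lemma isCompact_intervalUnion {l : ℕ} (a b : Fin l → ℝ) : IsCompact (intervalUnion a b) :=
  isCompact_iUnion fun k => isCompact_ofReal_image (a k) (b k)

lemma harmonicOnNhd_finset_sum {ι : Type*} (s : Finset ι) {u : ι → ℂ → ℝ} {O : Set ℂ}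
    (hu : ∀ i ∈ s, InnerProductSpace.HarmonicOnNhd (u i) O) :
    InnerProductSpace.HarmonicOnNhd (fun z => ∑ i ∈ s, u i z) O := by
  classical
  induction s using Finset.induction_on with
  | empty => simp only [Finset.sum_empty]; exact fun z _ => InnerProductSpace.harmonicAt_const (0 : ℝ)
  | insert i s hi ih =>
    have h1 := (hu i (Finset.mem_insert_self i s)).add
      (ih fun k hk => hu k (Finset.mem_insert_of_mem hk))
    refine fun z hz => ?_
    have h2 := h1 z hz
    convert h2 using 1
    ext w
    rw [Finset.sum_insert hi]; rfl

lemma IsHarmonicMeasureAtInfty.nonneg {F A : Set ℂ} {w : ℝ} (hF : IsCompact F) (hne : F.Nonempty)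
    (hw : IsHarmonicMeasureAtInfty F A w) : 0 ≤ w := by
  obtain ⟨u, huh, huA, hu0, hulim⟩ := hw
  have := (le_of_boundary_le hF hne huh.neg hulim.neg (M := 0) fun x hx η hη => ?_).2
  · linarith
  · by_cases hxA : x ∈ A
    · have := (huA x hxA).neg
      exact this.eventually_lt_const (by linarith)
    · have := (hu0 x ⟨hx, hxA⟩).neg
      exact this.eventually_lt_const (by linarith)

/-- The estimate behind the asymptotic formula. The differences `g - gI` and
`gc k + log |z - c k| - j k`, with `j k` the equilibrium potential of the `k`-th interval, have
almost constant boundary values on each interval and almost vanish on `E`, so that they are almost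
linear combinations of the functions `u i` defining the harmonic measures. The matrix `Γ` of the
coefficients of the latter is symmetric, so that evaluation at infinity
expresses `g - gI` by the functions `gc k`, with the harmonic measures as coefficients. -/
theorem exists_abs_green_sub_le {m : ℕ} {E : Set ℂ} (hE : IsCompact E) (hne : E.Nonempty)
    {c : Fin m → ℝ} (hcinj : Function.Injective c) (hcE : ∀ k, (c k : ℂ) ∉ E)
    {g : ℂ → ℝ} (hg : IsGreenAtInfty E g)
    {gc : Fin m → ℂ → ℝ} (hgc : ∀ k, IsGreenAt E (c k) (gc k)) :
    ∃ A, ∃ ρ₀ > 0, ∀ (B C ω : Fin m → ℝ) (gI : ℂ → ℝ) (ρ : ℝ), 0 ≤ ρ → ρ ≤ ρ₀ → (∀ k, B k < C k) →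
      (∀ k, c k ∈ Icc (B k) (C k)) → (∀ k, C k - B k ≤ ρ) →
      (∀ k, IsHarmonicMeasureAtInfty (E ∪ intervalUnion B C)
        ((fun x : ℝ => (x : ℂ)) '' Icc (B k) (C k)) (ω k)) →
      (∀ k, ω k ≤ 1) → IsGreenAtInfty (E ∪ intervalUnion B C) gI →
      ∀ r > 0, 2 * ρ ≤ r → ∀ z, z ∉ E ∪ intervalUnion B C → (∀ k, r ≤ ‖z - c k‖) →
      |g z - gI z - ∑ k, ω k * gc k z| ≤ A * (1 + 1 / r) * ρ := by
  -- the regular parts of the Green's functions with finite poles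
  have hφ' := fun k => exists_harmonic_eq_sub_log hE.isClosed (hcE k) (hgc k).harmonic (hgc k).pole
  choose φ hφh hφ using hφ'
  have hcne : ∀ {k i}, i ≠ k → (c i : ℂ) ≠ c k := fun h h' =>
    h (hcinj (Complex.ofReal_injective h'))
  -- Lipschitz constants near the points `c i`, and a bound `δ` for the distances
  obtain ⟨A₁, hA₁, δ, hδ, hloc⟩ : ∃ A ≥ 0, ∃ s > 0, ∀ i : Fin m,
      (∀ z : ℂ, ‖z - c i‖ ≤ s → |g z - g (c i)| ≤ A * ‖z - c i‖) ∧
      (∀ z : ℂ, ‖z - c i‖ ≤ s → |φ i z - φ i (c i)| ≤ A * ‖z - c i‖) ∧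
      (∀ z ∈ E, s ≤ ‖z - c i‖) := by
    refine exists_uniform_of_finite (fun i A A' s s' hA hs' hs h => ?_) fun i => ?_
    · refine ⟨fun z hz => (h.1 z (hz.trans hs)).trans ?_, fun z hz =>
        (h.2.1 z (hz.trans hs)).trans ?_, fun z hz => hs.trans (h.2.2 z hz)⟩
      · exact mul_le_mul_of_nonneg_right hA (norm_nonneg _)
      · exact mul_le_mul_of_nonneg_right hA (norm_nonneg _)
    · obtain ⟨A, hA, s, hs, h⟩ := HarmonicAt.exists_lipschitz (hg.harmonic _ (hcE i))
      obtain ⟨A', hA', s', hs', h'⟩ := HarmonicAt.exists_lipschitz (hφh i _ (hcE i))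
      obtain ⟨s'', hs'', h''⟩ := exists_pos_le_norm_sub hE.isClosed (hcE i)
      refine ⟨max A A', min (min s s') s'', by positivity, fun z hz => ?_, fun z hz => ?_,
        fun z hz => (min_le_right _ _).trans (h'' z hz)⟩
      · exact (h z (hz.trans ((min_le_left _ _).trans (min_le_left _ _)))).trans
          (mul_le_mul_of_nonneg_right (le_max_left _ _) (norm_nonneg _))
      · exact (h' z (hz.trans ((min_le_left _ _).trans (min_le_right _ _)))).trans
          (mul_le_mul_of_nonneg_right (le_max_right _ _) (norm_nonneg _))
  obtain ⟨A₂, hA₂, δ', hδ', hloc'⟩ : ∃ A ≥ 0, ∃ s > 0, ∀ ki : Fin m × Fin m, ki.1 ≠ ki.2 →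
      (∀ z : ℂ, ‖z - c ki.2‖ ≤ s → |gc ki.1 z - gc ki.1 (c ki.2)| ≤ A * ‖z - c ki.2‖) ∧
      2 * s ≤ ‖(c ki.1 : ℂ) - c ki.2‖ := by
    refine exists_uniform_of_finite (fun ki A A' s s' hA hs' hs h hne => ?_) fun ki => ?_
    · exact ⟨fun z hz => ((h hne).1 z (hz.trans hs)).trans
        (mul_le_mul_of_nonneg_right hA (norm_nonneg _)), by linarith [(h hne).2]⟩
    · by_cases hki : ki.1 = ki.2
      · exact ⟨0, 1, one_pos, fun h => absurd hki h⟩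
      · obtain ⟨A, hA, s, hs, h⟩ := HarmonicAt.exists_lipschitz
          ((hgc ki.1).harmonic (c ki.2) fun h => h.elim (hcE ki.2) (hcne (Ne.symm hki)))
        have h0 : 0 < ‖(c ki.1 : ℂ) - c ki.2‖ := norm_pos_iff.2 (sub_ne_zero.2 (hcne hki))
        exact ⟨A, min s (‖(c ki.1 : ℂ) - c ki.2‖ / 2), by positivity, fun _ =>
          ⟨fun z hz => h z (hz.trans (min_le_left _ _)),
            by linarith [min_le_right s (‖(c ki.1 : ℂ) - c ki.2‖ / 2)]⟩⟩
  set d := min δ δ' with hd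
  have hd0 : 0 < d := lt_min hδ hδ'
  have hdδ : d ≤ δ := min_le_left _ _
  have hdδ' : d ≤ δ' := min_le_right _ _
  set A₃ := A₁ + A₂ + 4 / d with hA₃
  have hA₃0 : 0 ≤ A₃ := by positivity
  refine ⟨A₃ + m * A₃ + m * A₃ + 2 * m, d / 4, by positivity, ?_⟩
  intro B C ω gI ρ hρ0 hρd hBC hcBC hlen hω hω1 hgI r hr hρr z hz hzr
  set F := E ∪ intervalUnion B C with hF
  have hFc : IsCompact F := hE.union (isCompact_intervalUnion B C)
  have hFne : F.Nonempty := hne.mono subset_union_left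
  have hEF : Fᶜ ⊆ Eᶜ := compl_subset_compl.2 subset_union_left
  have hω0 : ∀ k, 0 ≤ ω k := fun k => (hω k).nonneg hFc hFne
  set S : Fin m → Set ℂ := fun k => (fun x : ℝ => (x : ℂ)) '' Icc (B k) (C k) with hS
  have hSF : ∀ k, S k ⊆ F := fun k => (subset_iUnion S k).trans subset_union_right
  have hFS : ∀ x ∈ F, x ∈ E ∨ ∃ k, x ∈ S k := fun x hx => hx.imp id mem_iUnion.1
  have hSc : ∀ k, ∀ x ∈ S k, ‖x - c k‖ ≤ ρ := by
    rintro k x ⟨y, hy, rfl⟩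
    have h1 := hcBC k
    have h2 := hlen k
    simp only
    rw [← Complex.ofReal_sub, Complex.norm_real, Real.norm_eq_abs, abs_le]
    constructor <;> linarith [hy.1, hy.2, h1.1, h1.2]
  have hSE : ∀ k, ∀ x ∈ S k, x ∉ E := fun k x hx hxE => by
    linarith [hSc k x hx, (hloc k).2.2 x hxE]
  have hfar : ∀ k i, k ≠ i → ∀ x ∈ S i, d ≤ ‖x - c k‖ := by
    intro k i hki x hx
    have h1 := (hloc' (k, i) hki).2
    simp only at h1
    have h2 := norm_sub_le_norm_sub_add_norm_sub (c k : ℂ) x (c i)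
    rw [norm_sub_rev (c k : ℂ) x] at h2
    linarith [hSc i x hx]
  have hSS : ∀ k i, k ≠ i → ∀ x ∈ S i, x ∉ S k := fun k i hki x hx hxk => by
    linarith [hfar k i hki x hx, hSc k x hxk]
  choose u huh hu1 hu0 hulim using hω
  have hu1' : ∀ k, ∀ x ∈ S k, Tendsto (u k) (𝓝[Fᶜ] x) (𝓝 1) := hu1
  have hu0' : ∀ k, ∀ x ∈ E, Tendsto (u k) (𝓝[Fᶜ] x) (𝓝 0) := fun k x hx =>
    hu0 k x ⟨Or.inl hx, fun h => hSE k x h hx⟩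
  have hu0'' : ∀ k i, k ≠ i → ∀ x ∈ S i, Tendsto (u k) (𝓝[Fᶜ] x) (𝓝 0) := fun k i hki x hx =>
    hu0 k x ⟨hSF i hx, hSS k i hki x hx⟩
  have hsumE : ∀ a : Fin m → ℝ, ∀ x ∈ E,
      Tendsto (fun z => ∑ i, a i * u i z) (𝓝[Fᶜ] x) (𝓝 0) := by
    intro a x hx
    have := tendsto_finsetSum Finset.univ fun i _ => (hu0' i x hx).const_mul (a i)
    simpa using this
  have hsumS : ∀ a : Fin m → ℝ, ∀ i, ∀ x ∈ S i,
      Tendsto (fun z => ∑ i, a i * u i z) (𝓝[Fᶜ] x) (𝓝 (a i)) := by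
    intro a i x hx
    have h1 : ∀ k ∈ Finset.univ, Tendsto (fun z => a k * u k z) (𝓝[Fᶜ] x)
        (𝓝 (if k = i then a k else 0)) := by
      intro k _
      by_cases hki : k = i
      · subst hki
        have := (hu1' k x hx).const_mul (a k)
        simpa using this
      · have := (hu0'' k i hki x hx).const_mul (a k)
        simpa [hki] using this
    have := tendsto_finsetSum Finset.univ h1
    simpa using this
  have hsumlim : ∀ a : Fin m → ℝ,
      Tendsto (fun z => ∑ i, a i * u i z) (cocompact ℂ) (𝓝 (∑ i, a i * ω i)) := fun a =>
    tendsto_finsetSum Finset.univ fun i _ => (hulim i).const_mul (a i)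
  have hsumh : ∀ a : Fin m → ℝ,
      InnerProductSpace.HarmonicOnNhd (fun z => ∑ i, a i * u i z) Fᶜ := fun a =>
    harmonicOnNhd_finset_sum _ fun i _ => (huh i).const_smul (c := a i)
  have hu_le : ∀ k, |u k z| ≤ 1 := by
    intro k
    refine (abs_le_of_boundary_abs_le hFc hFne (huh k) (hulim k) fun x hx η hη => ?_).1 z hz
    by_cases hxk : x ∈ S k
    · exact (hu1' k x hxk).abs.eventually_lt_const (by rw [abs_one]; linarith)
    · exact (hu0 k x ⟨hx, hxk⟩).abs.eventually_lt_const (by rw [abs_zero]; linarith)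
  -- the equilibrium potentials of the intervals
  have hj' := fun k => exists_interval_potential (hBC k)
  choose j hjh hjS hj using hj'
  have hj : ∀ k, ∀ w : ℂ, ∀ s > 0, 2 * ρ ≤ s → s ≤ ‖w - c k‖ →
      |j k w - Real.log ‖w - c k‖| ≤ 2 * ρ / s := by
    intro k w s hs hρs hw
    refine (hj k (c k) (hcBC k) w (by linarith [hlen k])).trans ?_
    exact div_le_div₀ (by linarith [hρ0]) (by linarith [hlen k]) hs hw
  set P : Fin m → ℂ → ℝ := fun k => φ k - j k with hP
  have hPh : ∀ k, InnerProductSpace.HarmonicOnNhd (P k) Fᶜ := fun k w hw =>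
    (hφh k w (hEF hw)).sub (hjh k w fun h => hw (hSF k h))
  have hPgc : ∀ k, ∀ w : ℂ, ∀ s > 0, 2 * ρ ≤ s → s ≤ ‖w - c k‖ →
      |P k w - gc k w| ≤ 2 * ρ / s := by
    intro k w s hs hρs hw
    have hne : w ≠ c k := by
      rintro rfl
      rw [sub_self, norm_zero] at hw; linarith
    have h1 : P k w - gc k w = -(j k w - Real.log ‖w - c k‖) := by
      rw [hφ k w hne, hP]; simp only [Pi.sub_apply]; ring
    rw [h1, abs_neg]
    exact hj k w s hs hρs hw
  have hgclim : ∀ k, Tendsto (gc k) (cocompact ℂ) (𝓝 (g (c k))) := by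
    intro k
    obtain ⟨L, hL⟩ := (hgc k).infty
    rwa [(hgc k).limit_eq hE hne (hcE k) hL hg] at hL
  have hPlim : ∀ k, Tendsto (P k) (cocompact ℂ) (𝓝 (g (c k))) := by
    intro k
    have h4 : Tendsto (fun w : ℂ => P k w - gc k w) (cocompact ℂ) (𝓝 0) := by
      have h5 : Tendsto (fun z : ℂ => ‖z - c k‖) (cocompact ℂ) atTop := by
        rw [← Metric.cobounded_eq_cocompact]
        exact tendsto_norm_cobounded_atTop.comp (tendsto_sub_const_cobounded (c k : ℂ))
      refine squeeze_zero_norm' ?_ (h5.const_div_atTop (2 * ρ))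
      filter_upwards [h5.eventually_ge_atTop (2 * ρ + 1)] with w hw
      exact hPgc k w _ (by linarith [hρ0]) (by linarith) le_rfl
    have := (hgclim k).add h4
    rw [add_zero] at this
    exact this.congr fun w => by ring
  -- the matrix of boundary values
  set Γ : Fin m → Fin m → ℝ := fun k i =>
    if k = i then φ k (c k) - Real.log ((C k - B k) / 4) else gc k (c i) with hΓ
  have hΓsymm : ∀ k i, Γ k i = Γ i k := by
    intro k i
    by_cases hki : k = i
    · rw [hki]
    · simp only [hΓ, if_neg hki, if_neg (Ne.symm hki)]
      exact (hgc k).apply_eq hE hne (hcE k) (hcE i) (hcne hki) (hgc i)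
  have hA₁ρ : A₁ * ρ ≤ A₃ * ρ :=
    mul_le_mul_of_nonneg_right (by rw [hA₃]; linarith [show 0 ≤ 4 / d by positivity]) (hρ0)
  have hdρ : 2 * ρ / (d / 2) = 4 / d * ρ := by field_simp; ring
  have hA₄ρ : A₂ * ρ + 4 / d * ρ ≤ A₃ * ρ := by
    rw [← add_mul]
    exact mul_le_mul_of_nonneg_right (by rw [hA₃]; linarith) (hρ0)
  have hA₅ρ : 4 / d * ρ ≤ A₃ * ρ :=
    mul_le_mul_of_nonneg_right (by rw [hA₃]; linarith) (hρ0)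
  have hV : ∀ k, (∀ w, w ∉ F → |P k w - ∑ i, Γ k i * u i w| ≤ A₃ * ρ) ∧
      |g (c k) - ∑ i, Γ k i * ω i| ≤ A₃ * ρ := by
    intro k
    refine abs_le_of_boundary_abs_le hFc hFne ((hPh k).sub (hsumh (Γ k)))
      ((hPlim k).sub (hsumlim (Γ k))) fun x hx η hη => ?_
    rcases hFS x hx with hxE | ⟨i, hxi⟩
    · have h1 : Tendsto (fun w => |gc k w| + |∑ i, Γ k i * u i w|) (𝓝[Fᶜ] x) (𝓝 (|0| + |0|)) :=
        (((hgc k).boundary x hxE).mono_left (nhdsWithin_mono x hEF)).abs.add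
          (hsumE (Γ k) x hxE).abs
      have h2 : ∀ᶠ w : ℂ in 𝓝 x, d / 2 < ‖w - c k‖ := by
        have : ContinuousAt (fun w : ℂ => ‖w - c k‖) x := by fun_prop
        exact this.eventually_const_lt (by linarith [(hloc k).2.2 x hxE])
      filter_upwards [h1.eventually_lt_const (by rw [abs_zero, add_zero]; exact hη),
        nhdsWithin_le_nhds h2] with w h1 h2
      have h3 := hPgc k w (d / 2) (by positivity) (by linarith) h2.le
      rw [hdρ] at h3
      have h4 : P k w - ∑ i, Γ k i * u i w =
        (P k w - gc k w) + gc k w - ∑ i, Γ k i * u i w := by ring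
      simp only [Pi.sub_apply]
      rw [h4]
      calc |(P k w - gc k w) + gc k w - ∑ i, Γ k i * u i w|
          ≤ |(P k w - gc k w) + gc k w| + |∑ i, Γ k i * u i w| := abs_sub _ _
        _ ≤ |P k w - gc k w| + |gc k w| + |∑ i, Γ k i * u i w| := by
          gcongr; exact abs_add_le _ _
        _ < A₃ * ρ + η := by linarith [hA₅ρ]
    · have hxE : x ∉ E := hSE i x hxi
      have h1 := hsumS (Γ k) i x hxi
      by_cases hki : k = i
      · subst hki
        obtain ⟨y, hy, rfl⟩ := hxi
        have h2 : Tendsto (P k) (𝓝[Fᶜ] (y : ℂ)) (𝓝 (φ k y - Real.log ((C k - B k) / 4))) :=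
          ((hφh k y hxE).1.continuousAt.tendsto.sub (hjS k y hy)).mono_left nhdsWithin_le_nhds
        refine (h2.sub h1).abs.eventually_lt_const ?_
        have h3 : Γ k k = φ k (c k) - Real.log ((C k - B k) / 4) := if_pos rfl
        rw [h3, sub_sub_sub_cancel_right]
        have hyk := hSc k y ⟨y, hy, rfl⟩
        have h4 := (hloc k).2.1 y (by linarith)
        have h5 := mul_le_mul_of_nonneg_left hyk hA₁
        linarith [hA₁ρ]
      · have hxk := hfar k i hki x hxi
        have hxm : x ∈ (E ∪ {(c k : ℂ)})ᶜ := by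
          rintro (h | h)
          · exact hxE h
          · rw [mem_singleton_iff] at h
            rw [h, sub_self, norm_zero] at hxk; linarith
        have h2 : Tendsto (fun w => gc k w - ∑ i, Γ k i * u i w) (𝓝[Fᶜ] x)
            (𝓝 (gc k x - Γ k i)) :=
          (((hgc k).harmonic x hxm).1.continuousAt.tendsto.mono_left nhdsWithin_le_nhds).sub h1
        have h3 : Γ k i = gc k (c i) := if_neg hki
        have hxi' := hSc i x hxi
        have h4 := (hloc' (k, i) hki).1 x (by simp only; linarith)
        simp only at h4
        have h5 := mul_le_mul_of_nonneg_left hxi' hA₂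
        have h6 : |gc k x - Γ k i| < A₂ * ρ + η := by rw [h3]; linarith
        have h7 : ∀ᶠ w : ℂ in 𝓝 x, d / 2 < ‖w - c k‖ := by
          have : ContinuousAt (fun w : ℂ => ‖w - c k‖) x := by fun_prop
          exact this.eventually_const_lt (by linarith)
        filter_upwards [h2.abs.eventually_lt_const h6, nhdsWithin_le_nhds h7] with w h8 h9
        have h10 := hPgc k w (d / 2) (by positivity) (by linarith) h9.le
        rw [hdρ] at h10
        have h11 : P k w - ∑ i, Γ k i * u i w =
          (P k w - gc k w) + (gc k w - ∑ i, Γ k i * u i w) := by ring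
        simp only [Pi.sub_apply]
        rw [h11]
        refine (abs_add_le _ _).trans_lt ?_
        linarith [hA₄ρ]
  -- `g - gI` in terms of the functions `u i`
  have hD : |g z - gI z - ∑ i, g (c i) * u i z| ≤ A₃ * ρ := by
    obtain ⟨s, hs⟩ := hg.pole
    obtain ⟨s', hs'⟩ := hgI.pole
    have hlim : Tendsto (g - gI) (cocompact ℂ) (𝓝 (s - s')) :=
      (hs.sub hs').congr fun w => by simp
    have hA₃ρ : 0 ≤ A₃ * ρ := mul_nonneg hA₃0 hρ0
    refine (abs_le_of_boundary_abs_le hFc hFne (((hg.harmonic.mono hEF).sub hgI.harmonic).sub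
      (hsumh fun i => g (c i))) (hlim.sub (hsumlim fun i => g (c i))) fun x hx η hη => ?_).1 z hz
    have h0 := hgI.boundary x hx
    rcases hFS x hx with hxE | ⟨i, hxi⟩
    · have h1 := (hg.boundary x hxE).mono_left (nhdsWithin_mono x hEF)
      have h2 := ((h1.sub h0).sub (hsumE (fun i => g (c i)) x hxE)).abs
      exact h2.eventually_lt_const (by rw [sub_zero, sub_zero, abs_zero]; linarith)
    · have h1 : Tendsto g (𝓝[Fᶜ] x) (𝓝 (g x)) :=
        (hg.harmonic x (hSE i x hxi)).1.continuousAt.tendsto.mono_left nhdsWithin_le_nhds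
      have h2 := ((h1.sub h0).sub (hsumS (fun i => g (c i)) i x hxi)).abs
      refine h2.eventually_lt_const ?_
      rw [sub_zero]
      have h3 := (hloc i).1 x (by linarith [hSc i x hxi])
      have h4 := mul_le_mul_of_nonneg_left (hSc i x hxi) hA₁
      have h5 := hA₁ρ
      linarith
  -- comparison of the two expressions, by the symmetry of `Γ`
  have hdouble : ∑ k, (∑ i, Γ k i * ω i) * u k z = ∑ k, ω k * ∑ i, Γ k i * u i z := by
    simp only [Finset.sum_mul, Finset.mul_sum]
    rw [Finset.sum_comm]
    refine Finset.sum_congr rfl fun k _ => Finset.sum_congr rfl fun i _ => ?_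
    rw [hΓsymm i k]; ring
  have hid : g z - gI z - ∑ k, ω k * gc k z = (g z - gI z - ∑ i, g (c i) * u i z) +
      (∑ k, (g (c k) - ∑ i, Γ k i * ω i) * u k z -
        ∑ k, ω k * (P k z - ∑ i, Γ k i * u i z)) + ∑ k, ω k * (P k z - gc k z) := by
    simp only [sub_mul, mul_sub, Finset.sum_sub_distrib]
    rw [hdouble]; ring
  have hsum : ∀ (t : Fin m → ℝ) (M : ℝ), (∀ k, |t k| ≤ M) → |∑ k, t k| ≤ m * M := by
    intro t M ht
    refine (Finset.abs_sum_le_sum_abs _ _).trans ((Finset.sum_le_card_nsmul _ _ M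
      fun k _ => ht k).trans (le_of_eq ?_))
    simp
  have hA₃ρ : 0 ≤ A₃ * ρ := mul_nonneg hA₃0 hρ0
  have h1 := hsum (fun k => (g (c k) - ∑ i, Γ k i * ω i) * u k z) (A₃ * ρ) fun k => by
    rw [abs_mul]
    exact (mul_le_mul (hV k).2 (hu_le k) (abs_nonneg _) hA₃ρ).trans_eq (mul_one _)
  have h2 := hsum (fun k => ω k * (P k z - ∑ i, Γ k i * u i z)) (A₃ * ρ) fun k => by
    rw [abs_mul, abs_of_nonneg (hω0 k)]
    exact (mul_le_mul (hω1 k) ((hV k).1 z hz) (abs_nonneg _) zero_le_one).trans_eq (one_mul _)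
  have h3 := hsum (fun k => ω k * (P k z - gc k z)) (2 * ρ / r) fun k => by
    rw [abs_mul, abs_of_nonneg (hω0 k)]
    exact (mul_le_mul (hω1 k) (hPgc k z r hr hρr (hzr k)) (abs_nonneg _)
      zero_le_one).trans_eq (one_mul _)
  rw [hid]
  have hr' : 0 ≤ 1 / r := by positivity
  calc _ ≤ A₃ * ρ + (m * (A₃ * ρ) + m * (A₃ * ρ)) + m * (2 * ρ / r) :=
        (abs_add_le _ _).trans (add_le_add ((abs_add_le _ _).trans (add_le_add hD
          ((abs_sub _ _).trans (add_le_add h1 h2)))) h3)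
    _ = (A₃ + m * A₃ + m * A₃) * ρ * 1 + 2 * m * ρ * (1 / r) := by ring
    _ ≤ (A₃ + m * A₃ + m * A₃) * ρ * (1 + 1 / r) + 2 * m * ρ * (1 + 1 / r) := by
        gcongr <;> linarith
    _ = (A₃ + m * A₃ + m * A₃ + 2 * m) * (1 + 1 / r) * ρ := by ring

/-! ### Analytic continuation along paths -/

section LogBranch

variable {γ : ℝ → ℂ} {Λ : ℝ≥0}

lemma intervalIntegrable_complexGradient_mul_deriv {f : ℂ → ℝ} (hγ : LipschitzWith Λ γ)
    (hf : ∀ t ∈ Icc (0 : ℝ) 1, InnerProductSpace.HarmonicAt f (γ t)) :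
    IntervalIntegrable (fun t => complexGradient f (γ t) * deriv γ t) MeasureTheory.volume 0 1 := by
  have h1 : IntervalIntegrable (deriv γ) MeasureTheory.volume 0 1 := by
    refine (intervalIntegrable_const (c := (Λ : ℝ))).mono_fun
      (measurable_deriv γ).aestronglyMeasurable (Eventually.of_forall fun t => ?_)
    exact (norm_deriv_le_of_lipschitz hγ).trans (le_abs_self _)
  refine h1.continuousOn_mul ?_
  rw [uIcc_of_le zero_le_one]
  intro t ht
  exact ((HarmonicAt.differentiableAt_complexGradient (hf t ht)).continuousAt.comp
    hγ.continuous.continuousAt).continuousWithinAt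

lemma logBranch_add {f h : ℂ → ℝ} (hγ : LipschitzWith Λ γ)
    (hf : ∀ t ∈ Icc (0 : ℝ) 1, InnerProductSpace.HarmonicAt f (γ t))
    (hh : ∀ t ∈ Icc (0 : ℝ) 1, InnerProductSpace.HarmonicAt h (γ t)) :
    logBranch (f + h) γ = logBranch f γ + logBranch h γ := by
  have h1 : ∫ t in (0 : ℝ)..1, complexGradient (f + h) (γ t) * deriv γ t =
      ∫ t in (0 : ℝ)..1, (complexGradient f (γ t) * deriv γ t +
        complexGradient h (γ t) * deriv γ t) := by
    refine intervalIntegral.integral_congr fun t ht => ?_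
    rw [uIcc_of_le zero_le_one] at ht
    have h2 : fderiv ℝ (f + h) (γ t) = fderiv ℝ f (γ t) + fderiv ℝ h (γ t) :=
      fderiv_add ((hf t ht).1.differentiableAt two_ne_zero)
        ((hh t ht).1.differentiableAt two_ne_zero)
    simp only [complexGradient, h2, add_apply, Complex.ofReal_add]
    ring
  rw [logBranch, h1, intervalIntegral.integral_add
    (intervalIntegrable_complexGradient_mul_deriv hγ hf)
    (intervalIntegrable_complexGradient_mul_deriv hγ hh), logBranch, logBranch, Pi.add_apply,
    Complex.ofReal_add]
  ring

lemma logBranch_smul (f : ℂ → ℝ) (s : ℝ) (γ : ℝ → ℂ) :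
    logBranch (s • f) γ = s * logBranch f γ := by
  have h1 : ∀ z, complexGradient (s • f) z = s * complexGradient f z := by
    intro z
    have : fderiv ℝ (s • f) z = s • fderiv ℝ f z := by
      rw [fderiv_const_smul_field]; rfl
    simp only [complexGradient, this, smul_apply, smul_eq_mul, Complex.ofReal_mul]
    ring
  simp only [logBranch, h1, mul_assoc, intervalIntegral.integral_const_mul, Pi.smul_apply,
    smul_eq_mul, Complex.ofReal_mul]
  ring

lemma logBranch_sum {ι : Type*} (s : Finset ι) {f : ι → ℂ → ℝ} (hγ : LipschitzWith Λ γ)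
    (hf : ∀ i ∈ s, ∀ t ∈ Icc (0 : ℝ) 1, InnerProductSpace.HarmonicAt (f i) (γ t)) :
    logBranch (∑ i ∈ s, f i) γ = ∑ i ∈ s, logBranch (f i) γ := by
  classical
  induction s using Finset.induction_on with
  | empty =>
    have := logBranch_smul 0 0 γ
    rw [zero_smul, Complex.ofReal_zero, zero_mul] at this
    simpa using this
  | insert i s hi ih =>
    have h1 : ∀ k ∈ s, InnerProductSpace.HarmonicOnNhd (f k) (γ '' Icc 0 1) := by
      rintro k hk _ ⟨t, ht, rfl⟩
      exact hf k (Finset.mem_insert_of_mem hk) t ht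
    have h2 := harmonicOnNhd_finset_sum s h1
    have h3 : (fun z => ∑ k ∈ s, f k z) = ∑ k ∈ s, f k := by ext z; simp
    rw [h3] at h2
    rw [Finset.sum_insert hi, Finset.sum_insert hi,
      logBranch_add hγ (hf i (Finset.mem_insert_self i s))
        (fun t ht => h2 _ (mem_image_of_mem γ ht)),
      ih fun k hk => hf k (Finset.mem_insert_of_mem hk)]

/-- A harmonic function that is bounded by `μ` on the discs of radius `r` about the points of a path
has a small harmonic conjugate along the path, by the gradient estimate. -/
lemma norm_logBranch_le {f : ℂ → ℝ} {r μ : ℝ} (hr : 0 < r) (hγ : LipschitzWith Λ γ)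
    (hf : ∀ t ∈ Icc (0 : ℝ) 1, InnerProductSpace.HarmonicOnNhd f (Metric.ball (γ t) r))
    (hμ : ∀ t ∈ Icc (0 : ℝ) 1, ∀ z ∈ Metric.ball (γ t) r, |f z| ≤ μ) :
    ‖logBranch f γ‖ ≤ μ * (1 + 18 * Λ / r) := by
  have h0 : (0 : ℝ) ∈ Icc (0 : ℝ) 1 := ⟨le_rfl, zero_le_one⟩
  have hμ0 : 0 ≤ μ := (abs_nonneg _).trans (hμ 0 h0 (γ 0) (Metric.mem_ball_self hr))
  have h1 : ‖∫ t in (0 : ℝ)..1, complexGradient f (γ t) * deriv γ t‖ ≤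
      18 * μ / r * Λ * |1 - 0| := by
    refine intervalIntegral.norm_integral_le_of_norm_le_const fun t ht => ?_
    rw [uIoc_of_le zero_le_one] at ht
    have ht' : t ∈ Icc (0 : ℝ) 1 := Ioc_subset_Icc_self ht
    rw [norm_mul]
    exact mul_le_mul (norm_complexGradient_le hr (hf t ht') (hμ t ht'))
      (norm_deriv_le_of_lipschitz hγ) (norm_nonneg _) (by positivity)
  have h2 : ‖(f (γ 0) : ℂ)‖ ≤ μ := by
    rw [Complex.norm_real, Real.norm_eq_abs]
    exact hμ 0 h0 (γ 0) (Metric.mem_ball_self hr)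
  rw [sub_zero, abs_one, mul_one] at h1
  rw [logBranch]
  refine (norm_add_le _ _).trans ((add_le_add h2 h1).trans (le_of_eq ?_))
  ring

/-- If `logBranch` of `gI - g + ∑ ω k * gc k` is small, then `complexGreen gI` is close to the
quotient of the other complex Green's functions. -/
lemma exists_complexGreen_eq {m : ℕ} {g gI : ℂ → ℝ} {gc : Fin m → ℂ → ℝ} {ω : Fin m → ℝ} {η : ℝ}
    (hγ : LipschitzWith Λ γ)
    (hg : ∀ t ∈ Icc (0 : ℝ) 1, InnerProductSpace.HarmonicAt g (γ t))
    (hgI : ∀ t ∈ Icc (0 : ℝ) 1, InnerProductSpace.HarmonicAt gI (γ t))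
    (hgc : ∀ k, ∀ t ∈ Icc (0 : ℝ) 1, InnerProductSpace.HarmonicAt (gc k) (γ t))
    (hη : η ≤ 1) (h : ‖logBranch (gI + (-1 : ℝ) • g + ∑ k, ω k • gc k) γ‖ ≤ η) :
    ∃ ε : ℂ, ‖ε‖ ≤ 2 * η ∧ complexGreen gI γ =
      complexGreen g γ / (∏ k, complexGreenPow (gc k) (ω k) γ) * (1 + ε) := by
  have h1 : ∀ t ∈ Icc (0 : ℝ) 1, InnerProductSpace.HarmonicAt (∑ k, ω k • gc k) (γ t) := by
    intro t ht
    have h2 := harmonicOnNhd_finset_sum (u := fun k => ω k • gc k) (O := {γ t}) Finset.univ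
      fun k _ z hz => by
        rw [mem_singleton_iff] at hz
        rw [hz]; exact (hgc k t ht).const_smul
    have h3 : (fun z => ∑ k, (ω k • gc k) z) = ∑ k, ω k • gc k := by ext z; simp
    rw [h3] at h2
    exact h2 _ rfl
  rw [logBranch_add hγ (fun t ht => (hgI t ht).add (hg t ht).const_smul) h1,
    logBranch_add hγ hgI (fun t ht => (hg t ht).const_smul), logBranch_smul,
    logBranch_sum Finset.univ hγ (fun k _ t ht => (hgc k t ht).const_smul)] at h
  simp only [logBranch_smul] at h
  set e : ℂ := logBranch gI γ + ((-1 : ℝ) : ℂ) * logBranch g γ + ∑ k, (ω k : ℂ) * logBranch (gc k) γ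
    with he
  refine ⟨Complex.exp e - 1, ?_, ?_⟩
  · exact (Complex.norm_exp_sub_one_le (h.trans hη)).trans (by linarith)
  · have h4 : logBranch gI γ = logBranch g γ - ∑ k, (ω k : ℂ) * logBranch (gc k) γ + e := by
      rw [he]; push_cast; ring
    simp only [complexGreen, complexGreenPow]
    rw [h4, Complex.exp_add, Complex.exp_sub, Complex.exp_sum, add_sub_cancel]

end LogBranch

theorem theorem1 (l m : ℕ) (hl : 0 < l) (hm : 0 < m)
    -- `E = ⋃ j, [a j, b j]`, a union of `l` disjoint intervals
    (a b : Fin l → ℝ) (hab : ∀ j, a j < b j)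
    (hE : Pairwise fun i j => Disjoint (Icc (a i) (b i)) (Icc (a j) (b j)))
    -- `I n = ⋃ k, [B n k, C n k]`, a union of `m` disjoint intervals
    (B C : ℕ → Fin m → ℝ) (hBC : ∀ n k, B n k < C n k)
    (hI : ∀ n, Pairwise fun i j => Disjoint (Icc (B n i) (C n i)) (Icc (B n j) (C n j)))
    (hdist : ∃ δ > 0, ∀ n k j, ∀ x ∈ Icc (B n k) (C n k), ∀ y ∈ Icc (a j) (b j), δ ≤ |x - y|)
    (c : Fin m → ℝ) (hc : ∀ k, ⋂ n, Icc (B n k) (C n k) = {c k})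
    -- the harmonic measures `ω n k = ω(∞, [B n k, C n k], E ∪ I n)`
    (ω : ℕ → Fin m → ℝ)
    (hω : ∀ n k, IsHarmonicMeasureAtInfty (intervalUnion a b ∪ intervalUnion (B n) (C n))
      ((fun x : ℝ => (x : ℂ)) '' Icc (B n k) (C n k)) (ω n k))
    (hω0 : ∀ k, Tendsto (fun n => ω n k) atTop (𝓝 0))
    -- the Green's functions `g(·, ∞, E)`, `g(·, c k, E)` and `g(·, ∞, E ∪ I n)`
    (g : ℂ → ℝ) (hg : IsGreenAtInfty (intervalUnion a b) g)
    (gc : Fin m → ℂ → ℝ) (hgc : ∀ k, IsGreenAt (intervalUnion a b) (c k) (gc k))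
    (gI : ℕ → ℂ → ℝ)
    (hgI : ∀ n, IsGreenAtInfty (intervalUnion a b ∪ intervalUnion (B n) (C n)) (gI n)) :
    -- uniformly on compact sets `K`, along all paths in `K` of length at most `Λ`
    (∀ K : Set ℂ, IsCompact K → K ⊆ (intervalUnion a b ∪ range fun k => (c k : ℂ))ᶜ →
      ∀ Λ : ℝ≥0, ∃ M : ℝ, ∀ᶠ n in atTop, ∀ γ : ℝ → ℂ, LipschitzWith Λ γ →
        MapsTo γ (Icc 0 1) K →
        ∃ ε : ℂ, ‖ε‖ ≤ M * (⨆ k, ω n k ^ 2) ∧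
          complexGreen (gI n) γ =
            complexGreen g γ / (∏ k, complexGreenPow (gc k) (ω n k) γ) * (1 + ε)) ∧
    (∀ k, (fun n => C n k - B n k) =O[atTop] fun n => ⨆ k, ω n k ^ 2) := by
  set E := intervalUnion a b with hEdef
  have hEc : IsCompact E := isCompact_intervalUnion a b
  have hEne : E.Nonempty :=
    ⟨a ⟨0, hl⟩, mem_iUnion.2 ⟨⟨0, hl⟩, a ⟨0, hl⟩, left_mem_Icc.2 (hab _).le, rfl⟩⟩
  have hEre : ∀ z ∈ E, z.im = 0 := by
    intro z hz
    obtain ⟨j, x, -, rfl⟩ := mem_iUnion.1 hz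
    exact Complex.ofReal_im x
  have hcmem : ∀ n k, c k ∈ Icc (B n k) (C n k) := by
    intro n k
    have : c k ∈ ⋂ n, Icc (B n k) (C n k) := by rw [hc k]; rfl
    exact mem_iInter.1 this n
  have hcinj : Function.Injective c := by
    intro i j hij
    by_contra hne
    exact disjoint_left.1 (hI 0 hne) (hcmem 0 i) (hij ▸ hcmem 0 j)
  have hcE : ∀ k, (c k : ℂ) ∉ E := by
    intro k hk
    obtain ⟨δ, hδ, h⟩ := hdist
    obtain ⟨j, x, hx, hxc⟩ := mem_iUnion.1 hk
    have := h 0 k j (c k) (hcmem 0 k) x hx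
    rw [show x = c k from Complex.ofReal_injective hxc, sub_self, abs_zero] at this
    linarith
  -- the maximum of the squares and the sum of the harmonic measures
  set s : ℕ → ℝ := fun n => ⨆ k, ω n k ^ 2 with hs
  set W : ℕ → ℝ := fun n => ∑ k, ω n k with hW
  have hωs : ∀ n k, ω n k ^ 2 ≤ s n := fun n k =>
    le_ciSup (f := fun k => ω n k ^ 2) (finite_range _).bddAbove k
  have hs0 : ∀ n, 0 ≤ s n := fun n => (sq_nonneg _).trans (hωs n ⟨0, hm⟩)
  have hWs : ∀ n, W n ^ 2 ≤ m ^ 2 * s n := by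
    intro n
    have h1 := sq_sum_le_card_mul_sum_sq (s := Finset.univ) (f := ω n)
    have h2 := Finset.sum_le_card_nsmul Finset.univ (fun k => ω n k ^ 2) (s n) fun k _ => hωs n k
    simp only [Finset.card_univ, Fintype.card_fin, nsmul_eq_mul] at h1 h2
    calc W n ^ 2 ≤ m * ∑ k, ω n k ^ 2 := h1
      _ ≤ m * (m * s n) := by gcongr
      _ = m ^ 2 * s n := by ring
  have hWlim : Tendsto W atTop (𝓝 0) := by
    have := tendsto_finsetSum Finset.univ fun k _ => hω0 k
    simpa using this
  have hslim : Tendsto s atTop (𝓝 0) := by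
    have h1 : Tendsto (fun n => ∑ k, ω n k ^ 2) atTop (𝓝 0) := by
      have := tendsto_finsetSum Finset.univ fun k _ => (hω0 k).pow 2
      simpa using this
    have : Nonempty (Fin m) := ⟨⟨0, hm⟩⟩
    refine squeeze_zero hs0 (fun n => ciSup_le fun k => ?_) h1
    exact Finset.single_le_sum (f := fun k => ω n k ^ 2) (fun k _ => sq_nonneg _)
      (Finset.mem_univ k)
  -- lengths of the intervals: `∑ i, u i` is the function of `exists_length_le_mul_sq`
  have hlen : ∀ k, ∃ A, ∀ᶠ n in atTop, C n k - B n k ≤ A * s n := by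
    intro k
    obtain ⟨A, hA, η, hη, h⟩ := exists_length_le_mul_sq hEc hEne hEre (hcE k) (hgc k)
    have hsmall : ∀ᶠ n in atTop, A * W n ^ 2 < η / 2 := by
      have := (hWlim.pow 2).const_mul A
      refine this.eventually_lt_const ?_
      simpa using hη
    refine ⟨A * m ^ 2, hsmall.mono fun n hn => ?_⟩
    choose u huh hu1 hu0 hulim using hω n
    -- The intervals are not assumed to be nested or to shrink to points, so the length estimate is
    -- applied to the part of the `k`-th interval near `c k`, which turns out to be the whole of it.
    set B' := max (B n k) (c k - η / 2) with hB'
    set C' := min (C n k) (c k + η / 2) with hC'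
    have hck := hcmem n k
    have hBC' : B' < C' := by
      rcases hck.1.eq_or_lt with h1 | h1
      · exact max_lt (lt_min (hBC n k) (by linarith))
          (lt_min (by linarith [hck.2]) (by linarith))
      · have : B' < c k := max_lt h1 (by linarith)
        exact this.trans_le (le_min hck.2 (by linarith))
    have hseg : ∀ i, (fun x : ℝ => (x : ℂ)) '' Icc (B n i) (C n i) ⊆
        intervalUnion (B n) (C n) := fun i =>
      subset_iUnion (fun i => (fun x : ℝ => (x : ℂ)) '' Icc (B n i) (C n i)) i
    have hle := h (intervalUnion (B n) (C n)) (fun z => ∑ i, u i z) (W n) B' C'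
      (isCompact_intervalUnion _ _) (harmonicOnNhd_finset_sum _ fun i _ => huh i) ?_ ?_
      (tendsto_finsetSum _ fun i _ => hulim i) hBC'
      ⟨max_le hck.1 (by linarith), le_min hck.2 (by linarith)⟩ ?_ ?_
    · have h2 : C n k - B n k ≤ A * W n ^ 2 := by
        have h3 : C' - B' < η / 2 := hle.trans_lt hn
        have h4 : B' = B n k := by
          rcases max_choice (B n k) (c k - η / 2) with h | h
          · exact h
          · have : c k ≤ C' := le_min hck.2 (by linarith)
            rw [← hB'] at h
            linarith
        have h5 : C' = C n k := by
          rcases min_choice (C n k) (c k + η / 2) with h | h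
          · exact h
          · have : B' ≤ c k := max_le hck.1 (by linarith)
            rw [← hC'] at h
            linarith
        rwa [h4, h5] at hle
      calc C n k - B n k ≤ A * W n ^ 2 := h2
        _ ≤ A * (m ^ 2 * s n) := by gcongr; exact hWs n
        _ = A * m ^ 2 * s n := by ring
    · intro x hx
      have h1 : ∀ i ∈ Finset.univ, Tendsto (u i) (𝓝[(E ∪ intervalUnion (B n) (C n))ᶜ] x) (𝓝 0) := by
        intro i _
        refine hu0 i x ⟨Or.inl hx, ?_⟩
        rintro ⟨y, hy, rfl⟩
        obtain ⟨j, y', hy', hyy⟩ := mem_iUnion.1 hx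
        obtain ⟨δ, hδ, hd⟩ := hdist
        have := hd n i j y hy y' hy'
        rw [show y' = y from Complex.ofReal_injective hyy, sub_self, abs_zero] at this
        linarith
      simpa using tendsto_finsetSum Finset.univ h1
    · intro x hx
      obtain ⟨i, hi⟩ := mem_iUnion.1 hx
      have h1 : ∀ i' ∈ Finset.univ, Tendsto (u i') (𝓝[(E ∪ intervalUnion (B n) (C n))ᶜ] x)
          (𝓝 (if i' = i then 1 else 0)) := by
        intro i' _
        by_cases hii : i' = i
        · rw [if_pos hii, hii]; exact hu1 i x hi
        · rw [if_neg hii]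
          refine hu0 i' x ⟨Or.inr hx, ?_⟩
          rintro ⟨y, hy, hyx⟩
          obtain ⟨y', hy', hyx'⟩ := hi
          have : y = y' := Complex.ofReal_injective (hyx.trans hyx'.symm)
          exact disjoint_left.1 (hI n hii) hy (this ▸ hy')
      simpa using tendsto_finsetSum Finset.univ h1
    · refine (image_mono ?_).trans (hseg k)
      exact Icc_subset_Icc (le_max_left _ _) (min_le_left _ _)
    · linarith [le_max_right (B n k) (c k - η / 2), min_le_right (C n k) (c k + η / 2)]
  refine ⟨?_, fun k => ?_⟩
  · intro K hK hKsub Λ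
    obtain ⟨A, ρ₀, hρ₀, hmain⟩ := exists_abs_green_sub_le hEc hEne hcinj hcE hg hgc
    choose A' hA' using hlen
    obtain ⟨A₁, hA₁⟩ := (finite_range A').bddAbove
    set A₂ := max A₁ 0 with hA₂
    have hlen' : ∀ᶠ n in atTop, ∀ k, C n k - B n k ≤ A₂ * s n := by
      refine eventually_all.2 fun k => (hA' k).mono fun n hn => hn.trans ?_
      exact mul_le_mul_of_nonneg_right
        ((hA₁ (mem_range_self k)).trans (le_max_left _ _)) (hs0 n)
    have hopen : IsOpen (E ∪ range fun k => (c k : ℂ))ᶜ :=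
      (hEc.isClosed.union (finite_range _).isClosed).isOpen_compl
    obtain ⟨r₁, hr₁, hthick⟩ := hK.exists_thickening_subset_open hopen hKsub
    -- discs of radius `r` about the points of `K` stay at a distance `r` from the `c k`
    set r := r₁ / 2 with hr
    have hr0 : 0 < r := by positivity
    have hball : ∀ x ∈ K, ∀ z ∈ Metric.ball x r, z ∉ E ∧ ∀ k, r ≤ ‖z - c k‖ := by
      intro x hx z hz
      refine ⟨fun h => ?_, fun k => ?_⟩
      · refine hthick (Metric.mem_thickening_iff.2 ⟨x, hx, ?_⟩) (Or.inl h)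
        rw [Metric.mem_ball] at hz; linarith
      · by_contra hlt
        refine hthick (Metric.mem_thickening_iff.2 ⟨x, hx, ?_⟩)
          (Or.inr (mem_range_self k))
        rw [Metric.mem_ball] at hz
        rw [not_le, ← dist_eq_norm] at hlt
        linarith [dist_triangle_left (c k : ℂ) x z]
    set Q := A * (1 + 1 / r) * A₂ * (1 + 18 * Λ / r) with hQ
    have hlim : ∀ t : ℝ, Tendsto (fun n => t * s n) atTop (𝓝 0) := fun t => by
      simpa using hslim.const_mul t
    have hω1 : ∀ᶠ n in atTop, ∀ k, ω n k < 1 :=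
      eventually_all.2 fun k => (hω0 k).eventually_lt_const one_pos
    refine ⟨2 * Q, ?_⟩
    filter_upwards [hlen', (hlim A₂).eventually_lt_const hρ₀,
      (hlim A₂).eventually_lt_const (show 0 < r / 2 by positivity),
      (hlim Q).eventually_lt_const one_pos, hω1] with n hn1 hn2 hn3 hn4 hn5 γ hγ hγK
    have hballF : ∀ x ∈ K, ∀ z ∈ Metric.ball x r, z ∉ E ∪ intervalUnion (B n) (C n) := by
      rintro x hx z hz (h | h)
      · exact (hball x hx z hz).1 h
      · obtain ⟨k, y, hy, rfl⟩ := mem_iUnion.1 h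
        have h1 := (hball x hx _ hz).2 k
        have h2 := hcmem n k
        have h3 := hn1 k
        simp only at h1
        rw [← Complex.ofReal_sub, Complex.norm_real, Real.norm_eq_abs, le_abs] at h1
        rcases h1 with h1 | h1 <;> linarith [hy.1, hy.2, h2.1, h2.2]
    have hcball : ∀ x ∈ K, ∀ z ∈ Metric.ball x r, ∀ k, z ∈ (E ∪ {(c k : ℂ)})ᶜ := by
      rintro x hx z hz k (h | h)
      · exact (hball x hx z hz).1 h
      · have := (hball x hx z hz).2 k
        rw [mem_singleton_iff.1 h, sub_self, norm_zero] at this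
        linarith
    have hself : ∀ t ∈ Icc (0 : ℝ) 1, γ t ∈ Metric.ball (γ t) r := fun t _ =>
      Metric.mem_ball_self hr0
    have hsumeq : (fun z => ∑ k, (ω n k • gc k) z) = ∑ k, ω n k • gc k := by ext z; simp
    have hDh : ∀ t ∈ Icc (0 : ℝ) 1, InnerProductSpace.HarmonicOnNhd
        (gI n + (-1 : ℝ) • g + ∑ k, ω n k • gc k) (Metric.ball (γ t) r) := by
      intro t ht
      have h1 := harmonicOnNhd_finset_sum (u := fun k => ω n k • gc k) (O := Metric.ball (γ t) r)
        Finset.univ fun k _ z hz =>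
          ((hgc k).harmonic z (hcball _ (hγK ht) z hz k)).const_smul
      rw [hsumeq] at h1
      refine InnerProductSpace.HarmonicOnNhd.add (fun z hz => ?_) h1
      exact ((hgI n).harmonic z (hballF _ (hγK ht) z hz)).add
        (hg.harmonic z (hball _ (hγK ht) z hz).1).const_smul
    -- the estimate, with the bound `A₂ * s n` for the lengths
    have hDb : ∀ t ∈ Icc (0 : ℝ) 1, ∀ z ∈ Metric.ball (γ t) r,
        |(gI n + (-1 : ℝ) • g + ∑ k, ω n k • gc k) z| ≤ A * (1 + 1 / r) * (A₂ * s n) := by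
      intro t ht z hz
      have h1 := hmain (B n) (C n) (ω n) (gI n) (A₂ * s n)
        (mul_nonneg (le_max_right _ _) (hs0 n)) hn2.le (hBC n) (hcmem n) hn1 (hω n)
        (fun k => (hn5 k).le) (hgI n) r hr0 (by linarith) z (hballF _ (hγK ht) z hz)
        (hball _ (hγK ht) z hz).2
      have h2 : (gI n + (-1 : ℝ) • g + ∑ k, ω n k • gc k) z =
          -(g z - gI n z - ∑ k, ω n k * gc k z) := by
        simp only [Pi.add_apply, Pi.smul_apply, Finset.sum_apply, smul_eq_mul]
        ring
      rw [h2, abs_neg]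
      exact h1
    have hlog := norm_logBranch_le hr0 hγ hDh hDb
    obtain ⟨ε, hε, heq⟩ := exists_complexGreen_eq (η := Q * s n) hγ
      (fun t ht => hg.harmonic _ (hball _ (hγK ht) _ (hself t ht)).1)
      (fun t ht => (hgI n).harmonic _ (hballF _ (hγK ht) _ (hself t ht)))
      (fun k t ht => (hgc k).harmonic _ (hcball _ (hγK ht) _ (hself t ht) k)) hn4.le
      (hlog.trans (le_of_eq (by rw [hQ]; ring)))
    exact ⟨ε, by linarith, heq⟩
  · obtain ⟨A, hA⟩ := hlen k
    refine Asymptotics.IsBigO.of_bound A (hA.mono fun n hn => ?_)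
    rw [Real.norm_of_nonneg (by linarith [hBC n k]), Real.norm_of_nonneg (hs0 n)]
    exact hn
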